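/- Let $n,p\ge 1$. Let $\mathcal H=\ell^2(\mathbb N,\mathbb C)$ with the Hermitian form $Q(x,y)=\sum_{i<p}\overline{x_i}y_i-\sum_{i\ge p}\overline{x_i}y_i$ of signature $(p,\infty)$. Let $\mathcal X(p,\infty)$ be the symmetric space of $p$-dimensional linear subspaces of $\mathcal H$ on which $Q$ is positive definite, and let $\mathcal I_p(p,\infty)$ be the space of $p$-dimensional totally isotropic subspaces of $\mathcal H$, with the Borel structure of the Grassmann topology. Two elements $V,W$ of $\mathcal I_p(p,\infty)$ are transverse if $V\cap W=0$. A $p$-chain is a set of the form $\{V\in\mathcal I_p(p,\infty): V\subset F\}$ with $F\subset\mathcal H$ a linear subspace on which $Q$ has signature $(p,p)$. Identify $\partial\mathbb H^n_{\mathbb C}$ with the unit sphere of $\mathbb C^n$, with its Lebesgue measure. A chain is the intersection of this sphere with a complex affine line that meets the open unit ball. For $x\neq y$ in $\partial\mathbb H^n_{\mathbb C}$ there is exactly one chain $\mathcal C_{x,y}$ containing $x$ and $y$, and a property holds for almost every chain if it holds for $\mathcal C_{x,y}$ for almost every pair $(x,y)$. Let $\varphi:\partial\mathbb H^n_{\mathbb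 C}\to\mathcal I_p(p,\infty)$ be a measurable map that almost surely maps chains to $p$-chains, in the following sense: for almost every chain $C$ there is a $p$-chain $T$ such that $\varphi(z)\in T$ for almost every $z\in C$ (for the arc length), and for almost every pair $(x,y)$ the subspaces $\varphi(x)$ and $\varphi(y)$ are transverse. Then there is a linear subspace $E\subset\mathcal H$ on which $Q$ has signature $(p,np)$ such that, for almost every $x\in\partial\mathbb H^n_{\mathbb C}$, the point $\varphi(x)$ lies in the boundary of the finite-dimensional totally geodesic subspace $\mathcal X_{p,np}=\{V\in\mathcal X(p,\infty): V\subset E\}$, that is, in the set of elements of $\mathcal I_p(p,\infty)$ that are limits, in the Grassmannian, of sequences in $\mathcal X_{p,np}$ (equivalently, $\varphi(x)\subset E$). -/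

import Mathlib

open MeasureTheory Filter Topology
open scoped ComplexConjugate

noncomputable section

/-! ### The Hilbert space with its Hermitian form of signature `(p, ∞)` -/

/-- The separable complex Hilbert space `ℓ²(ℕ, ℂ)` of infinite dimension. -/
abbrev EllTwo : Type := lp (fun _ : ℕ => ℂ) 2

/-- The Hermitian form `Q(x, y) = ∑_{i < p} conj (x i) * y i - ∑_{i ≥ p} conj (x i) * y i`,
of signature `(p, ∞)`, on `ℓ²(ℕ, ℂ)`. -/
def hermForm (p : ℕ) (x y : EllTwo) : ℂ :=
  ∑ i ∈ Finset.range p, conj (x i) * y i - ∑' i : ℕ, conj (x (i + p)) * y (i + p)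

theorem hermForm_eq (p : ℕ) (x y : EllTwo) :
    hermForm p x y = 2 * ∑ i ∈ Finset.range p, conj (x i) * y i - inner ℂ x y := by
  have h := lp.hasSum_inner (𝕜 := ℂ) x y
  have h2 : ∀ i, inner ℂ (x i) (y i) = conj (x i) * y i := fun i => by
    rw [RCLike.inner_apply, mul_comm]
  simp only [h2] at h
  have h3 := h.summable.sum_add_tsum_nat_add p
  rw [h.tsum_eq] at h3
  rw [hermForm, ← h3]
  ring

theorem hermForm_add_left (p : ℕ) (x y z : EllTwo) :
    hermForm p (x + y) z = hermForm p x z + hermForm p y z := by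
  simp only [hermForm_eq, inner_add_left, lp.coeFn_add, Pi.add_apply, map_add, add_mul,
    Finset.sum_add_distrib]
  ring

theorem hermForm_smul_left (p : ℕ) (c : ℂ) (x y : EllTwo) :
    hermForm p (c • x) y = conj c * hermForm p x y := by
  simp only [hermForm_eq, inner_smul_left, lp.coeFn_smul, Pi.smul_apply, smul_eq_mul, map_mul,
    mul_assoc, ← Finset.mul_sum]
  ring

theorem hermForm_conj (p : ℕ) (x y : EllTwo) : conj (hermForm p x y) = hermForm p y x := by
  simp only [hermForm_eq, map_sub, map_mul, map_sum, inner_conj_symm, Complex.conj_conj,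
    Complex.conj_ofNat, mul_comm]

/-- The restriction of the form to the linear subspace `E` is nondegenerate of signature `(a, b)`:
`E` is the sum of two subspaces, orthogonal for the form, on which it is positive definite and
negative definite and whose dimensions are `a` and `b`. -/
def HasSignature (p : ℕ) (E : Submodule ℂ EllTwo) (a b : ℕ) : Prop :=
  ∃ P N : Submodule ℂ EllTwo,
    P ⊔ N = E ∧
    FiniteDimensional ℂ P ∧ Module.finrank ℂ P = a ∧
    FiniteDimensional ℂ N ∧ Module.finrank ℂ N = b ∧
    (∀ x ∈ P, x ≠ 0 → 0 < (hermForm p x x).re) ∧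
    (∀ x ∈ N, x ≠ 0 → (hermForm p x x).re < 0) ∧
    ∀ x ∈ P, ∀ y ∈ N, hermForm p x y = 0

/-! ### The symmetric space `𝒳(p, ∞)` and the space `ℐ_p(p, ∞)` in its boundary -/

/-- The symmetric space `𝒳(p, ∞)`: the `p`-dimensional linear subspaces on which the form is
positive definite. -/
structure SymmetricSpace (p : ℕ) where
  carrier : Submodule ℂ EllTwo
  finiteDimensional : FiniteDimensional ℂ carrier
  finrank_eq : Module.finrank ℂ carrier = p
  positive : ∀ x ∈ carrier, x ≠ 0 → 0 < (hermForm p x x).re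

/-- The space `ℐ_p(p, ∞)` of totally isotropic linear subspaces of dimension `p`. -/
structure IsotropicSubspace (p : ℕ) where
  carrier : Submodule ℂ EllTwo
  finiteDimensional : FiniteDimensional ℂ carrier
  finrank_eq : Module.finrank ℂ carrier = p
  isotropic : ∀ x ∈ carrier, ∀ y ∈ carrier, hermForm p x y = 0

/-- The orthogonal projection of the Hilbert space onto an element of `ℐ_p(p, ∞)`. -/
def IsotropicSubspace.proj {p : ℕ} (V : IsotropicSubspace p) : EllTwo →L[ℂ] EllTwo :=
  haveI := V.finiteDimensional
  V.carrier.starProjection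

/-- The Grassmann topology: the distance of two subspaces is the operator norm of the difference of
the orthogonal projections. -/
instance (p : ℕ) : TopologicalSpace (IsotropicSubspace p) :=
  TopologicalSpace.induced IsotropicSubspace.proj inferInstance

instance (p : ℕ) : MeasurableSpace (IsotropicSubspace p) := borel _

instance (p : ℕ) : BorelSpace (IsotropicSubspace p) := ⟨rfl⟩

/-- Two elements of `ℐ_p(p, ∞)` are transverse if they intersect trivially. -/
def IsotropicSubspace.Transverse {p : ℕ} (V W : IsotropicSubspace p) : Prop :=
  V.carrier ⊓ W.carrier = ⊥

/-- The points of `𝒳(p, ∞)` that are contained in the linear subspace `E`. If `E` has signature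
`(p, q)`, this is the standardly embedded totally geodesic subspace `𝒳(p, q)` given by `E`. -/
def standardSubspace (p : ℕ) (E : Submodule ℂ EllTwo) : Set (SymmetricSpace p) :=
  {V | V.carrier ≤ E}

/-- The part in `ℐ_p(p, ∞)` of the boundary of a subset `Y` of `𝒳(p, ∞)`: the elements `W` of
`ℐ_p(p, ∞)` that are limits, in the Grassmannian of `p`-dimensional subspaces, of a sequence in `Y`.
As all dimensions are `p`, this means that every vector of `W` is a limit of vectors of the
members of the sequence. -/
def boundaryAtInfinity {p : ℕ} (Y : Set (SymmetricSpace p)) : Set (IsotropicSubspace p) :=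
  {W | ∃ V : ℕ → SymmetricSpace p, (∀ k, V k ∈ Y) ∧
    ∀ w ∈ W.carrier, ∃ v : ℕ → EllTwo, (∀ k, v k ∈ (V k).carrier) ∧ Tendsto v atTop (𝓝 w)}

/-- A `p`-chain: the set of all elements of `ℐ_p(p, ∞)` that are contained in a fixed linear
subspace of signature `(p, p)`. -/
def IsPChain {p : ℕ} (T : Set (IsotropicSubspace p)) : Prop :=
  ∃ E : Submodule ℂ EllTwo, HasSignature p E p p ∧ T = {V | V.carrier ≤ E}

/-- The boundary in `ℐ_p(p, ∞)` of the totally geodesic subspace given by a linear subspace `E` of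
signature `(p, q)` consists of the elements of `ℐ_p(p, ∞)` that are contained in `E`. -/
theorem mem_boundaryAtInfinity_standardSubspace {p q : ℕ} {E : Submodule ℂ EllTwo}
    (hE : HasSignature p E p q) (W : IsotropicSubspace p) :
    W ∈ boundaryAtInfinity (standardSubspace p E) ↔ W.carrier ≤ E := by
  obtain ⟨P, N, hPN, hPf, hPd, hNf, hNd, hP, hN, hO⟩ := hE
  constructor
  · rintro ⟨V, hV, hW⟩ w hw
    obtain ⟨v, hv, hvw⟩ := hW w hw
    have : FiniteDimensional ℂ E := by rw [← hPN]; infer_instance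
    exact (Submodule.closed_of_finiteDimensional E).mem_of_tendsto hvw
      (Eventually.of_forall fun k => hV k (hv k))
  · intro hWE
    have hdisj : Disjoint N P := by
      rw [Submodule.disjoint_def]
      intro x hxN hxP
      by_contra hx
      exact lt_asymm (hP x hxP hx) (hN x hxN hx)
    obtain ⟨N', hNN', hcompl⟩ := hdisj.exists_isCompl
    let π : EllTwo →ₗ[ℂ] EllTwo := P.subtype ∘ₗ P.projectionOnto N' hcompl.symm
    have hπP : ∀ x, π x ∈ P := fun x => (P.projectionOnto N' hcompl.symm x).2
    have hπN : ∀ x ∈ E, x - π x ∈ N := by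
      intro x hx
      rw [← hPN] at hx
      obtain ⟨a, ha, b, hb, rfl⟩ := Submodule.mem_sup.1 hx
      have h1 : π a = a := congrArg Subtype.val
        (Submodule.projectionOnto_apply_left hcompl.symm ⟨a, ha⟩)
      have h2 : π b = 0 := congrArg Subtype.val
        (Submodule.projectionOnto_apply_right hcompl.symm ⟨b, hNN' hb⟩)
      rw [map_add, h1, h2]
      simpa using hb
    have hsplit : ∀ (x : EllTwo), x ∈ E → ∀ t : ℝ,
        (hermForm p (π x + (t : ℂ) • (x - π x)) (π x + (t : ℂ) • (x - π x))).re
          = (hermForm p (π x) (π x)).re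
            + t ^ 2 * (hermForm p (x - π x) (x - π x)).re := by
      intro x hx t
      have ho := hO _ (hπP x) _ (hπN x hx)
      have ho' : hermForm p (x - π x) (π x) = 0 := by rw [← hermForm_conj, ho, map_zero]
      have hr : ∀ a b c : EllTwo, hermForm p a (b + (t : ℂ) • c)
          = hermForm p a b + t * hermForm p a c := by
        intro a b c
        rw [← hermForm_conj, hermForm_add_left, hermForm_smul_left, map_add, map_mul,
          hermForm_conj, hermForm_conj, Complex.conj_conj]
      rw [hr, hermForm_add_left, hermForm_smul_left, hermForm_add_left, hermForm_smul_left, ho, ho']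
      simp [pow_two, mul_assoc]
    let t : ℕ → ℝ := fun k => 1 - 1 / ((k : ℝ) + 1)
    have ht : ∀ k, t k ^ 2 < 1 := by
      intro k
      have h1 : 0 < 1 / ((k : ℝ) + 1) := by positivity
      have h2 : 1 / ((k : ℝ) + 1) ≤ 1 := by
        rw [div_le_one (by positivity)]
        have : (0 : ℝ) ≤ k := Nat.cast_nonneg k
        linarith
      simp only [t]
      nlinarith
    let g : ℕ → EllTwo →ₗ[ℂ] EllTwo := fun k => π + ((t k : ℝ) : ℂ) • (LinearMap.id - π)
    have hg : ∀ k x, g k x = π x + ((t k : ℝ) : ℂ) • (x - π x) := fun k x => rfl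
    have hpos : ∀ k, ∀ x ∈ W.carrier, x ≠ 0 → 0 < (hermForm p (g k x) (g k x)).re := by
      intro k x hx hx0
      have h1 := hsplit x (hWE hx) 1
      have h2 := hsplit x (hWE hx) (t k)
      rw [hg, h2]
      have h3 : π x + ((1 : ℝ) : ℂ) • (x - π x) = x := by simp
      rw [h3, W.isotropic x hx x hx] at h1
      have h4 : π x ≠ 0 := by
        intro h0
        have h5 := hπN x (hWE hx)
        rw [h0, sub_zero] at h5
        have := hN x h5 hx0
        rw [W.isotropic x hx x hx] at this
        simp at this
      have h6 := hP _ (hπP x) h4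
      have h7 : (hermForm p (x - π x) (x - π x)).re = - (hermForm p (π x) (π x)).re := by
        simp at h1
        linarith
      rw [h7]
      nlinarith [ht k]
    have hinj : ∀ k, Function.Injective ((g k).domRestrict W.carrier) := by
      intro k
      rw [← LinearMap.ker_eq_bot, LinearMap.ker_eq_bot']
      intro x hx
      by_contra hx0
      have h1 := hpos k x x.2 (fun h => hx0 (Subtype.ext h))
      have h2 : g k x = 0 := hx
      rw [h2] at h1
      have h3 := hermForm_smul_left p 0 (0 : EllTwo) 0
      rw [zero_smul, map_zero, zero_mul] at h3
      rw [h3] at h1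
      simp at h1
    have := W.finiteDimensional
    refine ⟨fun k =>
      { carrier := LinearMap.range ((g k).domRestrict W.carrier)
        finiteDimensional := inferInstance
        finrank_eq := by rw [LinearMap.finrank_range_of_inj (hinj k), W.finrank_eq]
        positive := ?_ }, ?_, ?_⟩
    · rintro _ ⟨x, rfl⟩ h0
      refine hpos k x x.2 fun h => h0 ?_
      rw [LinearMap.domRestrict_apply, h, map_zero]
    · rintro k _ ⟨x, rfl⟩
      rw [LinearMap.domRestrict_apply, hg, ← hPN]
      exact Submodule.add_mem _ (Submodule.mem_sup_left (hπP _))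
        (Submodule.smul_mem _ _ (Submodule.mem_sup_right (hπN _ (hWE x.2))))
    · intro w hw
      refine ⟨fun k => g k w, fun k => ⟨⟨w, hw⟩, rfl⟩, ?_⟩
      have h1 : Tendsto t atTop (𝓝 1) := by
        have := tendsto_one_div_add_atTop_nhds_zero_nat (𝕜 := ℝ)
        simpa [t] using this.const_sub 1
      have h2 : Tendsto (fun k => ((t k : ℝ) : ℂ)) atTop (𝓝 ((1 : ℝ) : ℂ)) :=
        (Complex.continuous_ofReal.tendsto 1).comp h1
      have h3 := (h2.smul_const (w - π w)).const_add (π w)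
      simpa [hg] using h3

/-! ### The boundary of complex hyperbolic space and its chains -/

/-- The boundary of complex hyperbolic `n`-space, in the ball model: the unit sphere of `ℂⁿ`. -/
abbrev HypBoundary (n : ℕ) : Type := Metric.sphere (0 : EuclideanSpace ℂ (Fin n)) 1

/-- The Lebesgue (surface) measure on the sphere. -/
def boundaryMeasure (n : ℕ) : Measure (HypBoundary n) :=
  (volume : Measure (EuclideanSpace ℂ (Fin n))).toSphere

/-- For `x ≠ y`, the unique chain that contains `x` and `y`: the intersection of the sphere with the
complex line through `x` and `y`. -/
def chain {n : ℕ} (x y : HypBoundary n) : Set (HypBoundary n) :=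
  {z | ∃ c : ℂ, (z : EuclideanSpace ℂ (Fin n)) = x + c • ((y : EuclideanSpace ℂ (Fin n)) - x)}

/-- A chain `C`, which is a round circle, is generic for `φ` if there is a `p`-chain that contains
`φ z` for almost every point `z` of `C` with respect to the arc length. -/
def IsGenericChain {n p : ℕ} (φ : HypBoundary n → IsotropicSubspace p)
    (C : Set (HypBoundary n)) : Prop :=
  ∃ T : Set (IsotropicSubspace p), IsPChain T ∧ ∀ᵐ z ∂(μH[1].restrict C), φ z ∈ T

/-- Almost every chain is generic for `φ`. The Lebesgue measure class on the manifold of all chains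
is the image of the one on pairs of distinct points of the sphere under the surjective submersion
that sends `(x, y)` to the chain through `x` and `y`. -/
def AlmostSurelyMapsChainsToChains {n p : ℕ} (φ : HypBoundary n → IsotropicSubspace p) : Prop :=
  ∀ᵐ xy ∂((boundaryMeasure n).prod (boundaryMeasure n)), IsGenericChain φ (chain xy.1 xy.2)

end

open MeasureTheory Filter Topology
open scoped ComplexConjugate

noncomputable section

/-! ### Measurable families of finite-dimensional subspaces -/

/-! Seen from a point `x` of the sphere, the chains through `x` are complex directions `v`, and any
other chain projects from `x` into a complex projective line of directions. Almost every point of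
almost every chain is sent into a space of dimension at most `2p`, which two transverse images
already span. So a generic direction `v` carries the subspace `ψ v = φ x + φ y`, the same for almost
every `y` on its chain. If `z` lies on the chain through `y₁` and `y₂`, then `φ z ⊂ φ y₁ + φ y₂`,
hence `ψ (z - x) ⊂ ψ (y₁ - x) + ψ (y₂ - x)`: the family `ψ` has the span property on projective
lines. Therefore `n` independent directions control almost all of it (`exists_ae_le_iSup`). All `ψ
v` contain `φ x` and have dimension at most `2p`, so the resulting space `W` has dimension at most
`p + np` (`exists_finrank_le_ae_le`).

It remains to find signature `(p, np)`. A transverse pair of isotropic subspaces inside `W` spans a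
positive definite `p`-space (`exists_positive_le_sup`). Since the form has only `p` positive
directions, the orthogonal complement of this `p`-space in any enlargement of `W` is negative
definite (`hasSignature_of_positive`).

The difficulty is that every incidence holds only almost everywhere. Chains through `x` are orbits
of complex reflections, and the pair (direction, angle) describes the null sets of the sphere
(`ae_sphereRot`, `ae_of_ae_sphereRot`). As reflections preserve null sets, the base point of a chain
may itself be taken generic (`ae_sphereRot_le_sup`). For fixed directions `v₁, v₂` and a fixed `y₁`,
the two angles of `y₂` and `z` make the direction of `z` cover almost all of the line `v₁ + γ v₂`
(`ae_add_smul_of_ae_sphereRot`). Exchanging quantifiers by Fubini requires measurability of the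
inclusions between subspaces (`MeasurableFamily.measurableSet_le`). -/

instance : MeasurableSpace EllTwo := borel _

instance : BorelSpace EllTwo := ⟨rfl⟩

theorem hasSum_lp_single (x : EllTwo) : HasSum (fun i => lp.single 2 i (x i)) x :=
  lp.hasSum_single (by norm_num) x

instance : TopologicalSpace.SeparableSpace EllTwo := by
  classical
  rw [← TopologicalSpace.isSeparable_univ_iff]
  have h1 : (Set.range fun i : ℕ => (lp.single 2 i (1 : ℂ) : EllTwo)).Countable :=
    Set.countable_range _
  have h2 := (h1.isSeparable.span (R := ℂ)).closure
  refine h2.mono fun x _ => ?_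
  refine mem_closure_of_tendsto (hasSum_lp_single x) (Eventually.of_forall fun s => ?_)
  refine Submodule.sum_mem _ fun i _ => ?_
  have h3 : (lp.single 2 i (x i) : EllTwo) = x i • (lp.single 2 i (1 : ℂ) : EllTwo) := by
    rw [← lp.single_smul, smul_eq_mul, mul_one]
  rw [h3]
  exact Submodule.smul_mem _ _ (Submodule.subset_span ⟨i, rfl⟩)

instance : SecondCountableTopology EllTwo :=
  UniformSpace.secondCountable_of_separable EllTwo

/-- A family of finite-dimensional subspaces, depending on a parameter, that has a dense sequence
of measurable sections. -/
structure MeasurableFamily {Ω : Type*} [MeasurableSpace Ω] (S : Ω → Submodule ℂ EllTwo) :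
    Prop where
  finiteDimensional : ∀ ω, FiniteDimensional ℂ (S ω)
  exists_dense : ∃ s : ℕ → Ω → EllTwo, (∀ k, Measurable (s k)) ∧
    ∀ ω, closure (Set.range fun k => s k ω) = S ω

namespace MeasurableFamily

variable {Ω Ω' : Type*} [MeasurableSpace Ω] [MeasurableSpace Ω'] {S T : Ω → Submodule ℂ EllTwo}

theorem comp (hS : MeasurableFamily S) {f : Ω' → Ω} (hf : Measurable f) :
    MeasurableFamily fun ω => S (f ω) := by
  obtain ⟨s, hs, hd⟩ := hS.exists_dense
  exact ⟨fun ω => hS.finiteDimensional _, fun k ω => s k (f ω), fun k => (hs k).comp hf,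
    fun ω => hd _⟩

theorem const (W : Submodule ℂ EllTwo) [FiniteDimensional ℂ W] :
    MeasurableFamily fun _ : Ω => W := by
  refine ⟨fun _ => inferInstance, fun k _ => TopologicalSpace.denseSeq W k,
    fun k => measurable_const, fun _ => ?_⟩
  have h := TopologicalSpace.denseRange_denseSeq W
  have h2 : (Set.range fun k => (TopologicalSpace.denseSeq W k : EllTwo))
      = Subtype.val '' Set.range (TopologicalSpace.denseSeq W) := by
    rw [← Set.range_comp]; rfl
  rw [h2]
  apply Set.Subset.antisymm
  · refine closure_minimal ?_ (Submodule.closed_of_finiteDimensional W)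
    rintro _ ⟨x, _, rfl⟩
    exact x.2
  · intro x hx
    have := image_closure_subset_closure_image (f := (Subtype.val : W → EllTwo))
      continuous_subtype_val (s := Set.range (TopologicalSpace.denseSeq W))
    apply this
    exact ⟨⟨x, hx⟩, by rw [h.closure_range]; trivial, rfl⟩

theorem sup (hS : MeasurableFamily S) (hT : MeasurableFamily T) :
    MeasurableFamily fun ω => S ω ⊔ T ω := by
  obtain ⟨s, hs, hds⟩ := hS.exists_dense
  obtain ⟨t, ht, hdt⟩ := hT.exists_dense
  have hSf := hS.finiteDimensional
  have hTf := hT.finiteDimensional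
  refine ⟨fun ω => inferInstance, fun k ω => s k.unpair.1 ω + t k.unpair.2 ω,
    fun k => (hs _).add (ht _), fun ω => ?_⟩
  apply Set.Subset.antisymm
  · refine closure_minimal ?_ (Submodule.closed_of_finiteDimensional _)
    rintro _ ⟨k, rfl⟩
    refine Submodule.add_mem_sup ?_ ?_
    · rw [← SetLike.mem_coe, ← hds]; exact subset_closure ⟨_, rfl⟩
    · rw [← SetLike.mem_coe, ← hdt]; exact subset_closure ⟨_, rfl⟩
  · intro x hx
    obtain ⟨a, ha, b, hb, rfl⟩ := Submodule.mem_sup.1 hx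
    rw [← SetLike.mem_coe, ← hds] at ha
    rw [← SetLike.mem_coe, ← hdt] at hb
    refine map_mem_closure₂ continuous_add ha hb ?_
    rintro _ ⟨k, rfl⟩ _ ⟨l, rfl⟩
    exact ⟨Nat.pair k l, by simp⟩

/-- Finite-dimensional subspaces are closed, so the inclusion says that each section of the first
family is approximated by sections of the second: countably many measurable conditions. Every later
use of Fubini rests on this. -/
theorem measurableSet_le (hS : MeasurableFamily S) (hT : MeasurableFamily T) :
    MeasurableSet {ω | S ω ≤ T ω} := by
  obtain ⟨s, hs, hds⟩ := hS.exists_dense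
  obtain ⟨t, ht, hdt⟩ := hT.exists_dense
  have hTf := hT.finiteDimensional
  have : {ω | S ω ≤ T ω}
      = ⋂ k : ℕ, ⋂ j : ℕ, ⋃ l : ℕ, {ω | dist (s k ω) (t l ω) < 1 / ((j : ℝ) + 1)} := by
    ext ω
    simp only [Set.mem_ofPred_eq, Set.mem_iInter, Set.mem_iUnion]
    have key : S ω ≤ T ω ↔ ∀ k, s k ω ∈ closure (Set.range fun l => t l ω) := by
      rw [hdt]
      constructor
      · intro h k
        exact h (by rw [← SetLike.mem_coe, ← hds]; exact subset_closure ⟨k, rfl⟩)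
      · intro h
        rw [← SetLike.coe_subset_coe, ← hds]
        refine closure_minimal ?_ (Submodule.closed_of_finiteDimensional _)
        rintro _ ⟨k, rfl⟩
        exact h k
    rw [key]
    refine forall_congr' fun k => ?_
    rw [Metric.mem_closure_range_iff]
    constructor
    · intro h j
      exact h _ (by positivity)
    · intro h ε hε
      obtain ⟨j, hj⟩ := exists_nat_one_div_lt hε
      obtain ⟨l, hl⟩ := h j
      exact ⟨l, hl.trans hj⟩
  rw [this]
  exact MeasurableSet.iInter fun k => MeasurableSet.iInter fun j => MeasurableSet.iUnion fun l =>
    measurableSet_lt ((hs k).dist (ht l)) measurable_const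

end MeasurableFamily

/-- The orthogonal projection depends continuously on the subspace by the definition of the
topology, so the projections of a fixed dense sequence serve as sections. -/
theorem IsotropicSubspace.measurableFamily_carrier (p : ℕ) :
    MeasurableFamily fun V : IsotropicSubspace p => V.carrier := by
  refine ⟨fun V => V.finiteDimensional, fun k V => V.proj (TopologicalSpace.denseSeq EllTwo k),
    fun k => ?_, fun V => ?_⟩
  · have h1 : Continuous fun V : IsotropicSubspace p => V.proj := continuous_induced_dom
    exact (h1.clm_apply continuous_const).measurable
  · have := V.finiteDimensional
    apply Set.Subset.antisymm
    · refine closure_minimal ?_ (Submodule.closed_of_finiteDimensional V.carrier)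
      rintro _ ⟨k, rfl⟩
      exact Submodule.starProjection_apply_mem _ _
    · intro x hx
      have h2 : V.proj x = x := Submodule.starProjection_eq_self_iff.2 hx
      rw [← h2]
      have h3 := (TopologicalSpace.denseRange_denseSeq EllTwo) x
      have h4 := mem_closure_image (f := V.proj) V.proj.continuous.continuousAt h3
      rwa [← Set.range_comp] at h4

/-! ### Iterated almost everywhere statements -/

theorem measurableSet_ae {α β : Type*} [MeasurableSpace α] [MeasurableSpace β] (ν : Measure β)
    [SFinite ν] {p : α → β → Prop} (h : MeasurableSet {q : α × β | p q.1 q.2}) :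
    MeasurableSet {a | ∀ᵐ b ∂ν, p a b} := by
  have h1 := measurable_measure_prodMk_left (ν := ν) h.compl
  exact h1 (measurableSet_singleton 0)

theorem ae_of_ae_translate {G : Type*} [NormedAddCommGroup G] [MeasurableSpace G] [BorelSpace G]
    [SecondCountableTopology G]
    (μ : Measure G) [μ.IsAddLeftInvariant] (a : G) {p : G → Prop} (h : ∀ᵐ x ∂μ, p x) :
    ∀ᵐ x ∂μ, p (a + x) :=
  (measurePreserving_add_left μ a).quasiMeasurePreserving.ae h

/-! ### Complex reflections and the chains through a point -/

section Rotation

variable {V : Type*} [NormedAddCommGroup V] [InnerProductSpace ℂ V]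

/-- The orthogonal projection of `x` to the complex line of `v`. -/
def lineProj (v x : V) : V := (inner ℂ v x / (‖v‖ : ℂ) ^ 2) • v

/-- The complex reflection that multiplies the vector `v` by `exp (2 i θ)` and fixes its orthogonal
complement. The orbits of `x` for fixed `v` are the chains through `x` in direction `v`. -/
def rot (v : V) (θ : ℝ) (x : V) : V := x - (1 - Complex.exp (2 * θ * Complex.I)) • lineProj v x

theorem lineProj_zero_left (x : V) : lineProj 0 x = 0 := by simp [lineProj]

theorem lineProj_smul_left {c : ℂ} (hc : c ≠ 0) (v x : V) : lineProj (c • v) x = lineProj v x := by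
  by_cases hv : v = 0
  · simp [hv]
  have h1 : (‖v‖ : ℂ) ≠ 0 := by simpa using hv
  have h2 : (‖c‖ : ℂ) ≠ 0 := by simpa using hc
  have h3 : conj c * c = (‖c‖ : ℂ) ^ 2 := by
    rw [mul_comm, Complex.mul_conj, Complex.normSq_eq_norm_sq]; push_cast; rfl
  rw [lineProj, lineProj, smul_smul, inner_smul_left, norm_smul]
  congr 1
  push_cast
  field_simp
  rw [← h3]; ring

theorem rot_smul_left {c : ℂ} (hc : c ≠ 0) (v : V) (θ : ℝ) (x : V) :
    rot (c • v) θ x = rot v θ x := by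
  rw [rot, rot, lineProj_smul_left hc]

theorem lineProj_lineProj (v x : V) : lineProj v (lineProj v x) = lineProj v x := by
  by_cases hv : v = 0
  · simp [hv, lineProj_zero_left]
  have h1 : (‖v‖ : ℂ) ≠ 0 := by simpa using hv
  simp only [lineProj, inner_smul_right, inner_self_eq_norm_sq_to_K]
  congr 1
  field_simp
  rfl

theorem lineProj_add (v x y : V) : lineProj v (x + y) = lineProj v x + lineProj v y := by
  simp [lineProj, add_div, add_smul]

theorem lineProj_smul (v : V) (c : ℂ) (x : V) : lineProj v (c • x) = c • lineProj v x := by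
  simp [lineProj, smul_smul, mul_div_assoc]

theorem inner_sub_lineProj (v x : V) : inner ℂ v (x - lineProj v x) = 0 := by
  by_cases hv : v = 0
  · simp [hv]
  have h1 : (‖v‖ : ℂ) ≠ 0 := by simpa using hv
  rw [inner_sub_right, lineProj, inner_smul_right, inner_self_eq_norm_sq_to_K]
  simp only [Complex.coe_algebraMap]
  field_simp
  ring

theorem norm_rot (v : V) (θ : ℝ) (x : V) : ‖rot v θ x‖ = ‖x‖ := by
  set e := Complex.exp (2 * θ * Complex.I)
  have he : ‖e‖ = 1 := by
    have := Complex.norm_exp_ofReal_mul_I (2 * θ)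
    simpa [e] using this
  have h0 : inner ℂ (lineProj v x) (x - lineProj v x) = 0 := by
    rw [lineProj, inner_smul_left, ← lineProj, inner_sub_lineProj, mul_zero]
  have h0' : ∀ c : ℂ, inner ℂ (c • lineProj v x) (x - lineProj v x) = 0 := by
    intro c; rw [inner_smul_left, h0, mul_zero]
  have h1 : rot v θ x = e • lineProj v x + (x - lineProj v x) := by
    rw [rot]; module
  have h2 : x = (1 : ℂ) • lineProj v x + (x - lineProj v x) := by module
  have h3 := norm_add_sq_eq_norm_sq_add_norm_sq_of_inner_eq_zero _ _ (h0' e)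
  have h4 := norm_add_sq_eq_norm_sq_add_norm_sq_of_inner_eq_zero _ _ (h0' 1)
  rw [← h1, norm_smul, he] at h3
  rw [← h2, norm_smul, norm_one] at h4
  exact (mul_self_inj (norm_nonneg _) (norm_nonneg _)).1 (h3.trans h4.symm)

theorem rot_rot (v : V) (θ θ' : ℝ) (x : V) : rot v θ (rot v θ' x) = rot v (θ + θ') x := by
  have h : Complex.exp (2 * ((θ + θ' : ℝ) : ℂ) * Complex.I)
      = Complex.exp (2 * θ * Complex.I) * Complex.exp (2 * θ' * Complex.I) := by
    rw [← Complex.exp_add]; congr 1; push_cast; ring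
  have h1 : lineProj v (rot v θ' x) = Complex.exp (2 * θ' * Complex.I) • lineProj v x := by
    rw [rot, sub_eq_add_neg, ← neg_smul, lineProj_add, lineProj_smul, lineProj_lineProj]
    module
  rw [rot, h1, rot, rot, h]
  module

theorem rot_zero (v x : V) : rot v 0 x = x := by simp [rot]

/-- Complex reflections as linear isometries. -/
def rotEquiv (v : V) (θ : ℝ) : V ≃ₗᵢ[ℂ] V where
  toFun := rot v θ
  invFun := rot v (-θ)
  map_add' x y := by
    simp only [rot, lineProj_add]; module
  map_smul' c x := by
    simp only [rot, lineProj_smul, RingHom.id_apply]; module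
  left_inv x := by rw [rot_rot, neg_add_cancel, rot_zero]
  right_inv x := by rw [rot_rot, add_neg_cancel, rot_zero]
  norm_map' := norm_rot v θ

theorem rot_sub_self (v : V) (θ : ℝ) (x : V) :
    rot v θ x - x = (-((1 - Complex.exp (2 * θ * Complex.I)) * (inner ℂ v x / (‖v‖ : ℂ) ^ 2))) • v := by
  rw [rot, lineProj]; module

theorem exp_two_mul_sub_one (θ : ℝ) : 1 - Complex.exp (2 * θ * Complex.I)
    = -(2 * Complex.I * Real.sin θ * Complex.exp (θ * Complex.I)) := by
  have h : Complex.exp (2 * θ * Complex.I)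
      = Complex.exp (θ * Complex.I) * Complex.exp (θ * Complex.I) := by
    rw [← Complex.exp_add]; congr 1; ring
  have h2 : Complex.exp (θ * Complex.I) * Complex.exp (-(θ * Complex.I)) = 1 := by
    rw [← Complex.exp_add, add_neg_cancel, Complex.exp_zero]
  have h3 : Complex.exp (θ * Complex.I) = Complex.cos θ + Complex.sin θ * Complex.I :=
    Complex.exp_mul_I _
  have h4 : Complex.exp (-(θ * Complex.I)) = Complex.cos θ - Complex.sin θ * Complex.I := by
    rw [← neg_mul, Complex.exp_mul_I, Complex.cos_neg, Complex.sin_neg]; ring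
  rw [h]
  push_cast
  nth_rewrite 1 [← h2]
  rw [h4]
  nth_rewrite 3 [h3]
  ring

theorem exp_two_mul_ne_one {θ : ℝ} (h : Real.sin θ ≠ 0) :
    1 - Complex.exp (2 * θ * Complex.I) ≠ 0 := by
  rw [exp_two_mul_sub_one, neg_ne_zero]
  have h1 : ((Real.sin θ : ℝ) : ℂ) ≠ 0 := by exact_mod_cast h
  exact mul_ne_zero (mul_ne_zero (mul_ne_zero two_ne_zero Complex.I_ne_zero) h1)
    (Complex.exp_ne_zero _)

theorem ae_sin_ne_zero : ∀ᵐ θ : ℝ, Real.sin θ ≠ 0 := by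
  have h : {θ : ℝ | Real.sin θ = 0} = Set.range fun k : ℤ => (k : ℝ) * Real.pi := by
    ext θ
    simp [Real.sin_eq_zero_iff]
  have h2 : {θ : ℝ | Real.sin θ = 0}.Countable := by
    rw [h]; exact Set.countable_range _
  exact h2.ae_notMem volume

/-- If `x + c v` has the same norm as `x`, it lies on the orbit of `x` under the reflections in
direction `v`. -/
theorem exists_rot_eq {v x : V} {c : ℂ} (hc : c ≠ 0) (hv : v ≠ 0) (h : ‖x + c • v‖ = ‖x‖) :
    ∃ θ : ℝ, rot v θ x = x + c • v ∧
      c = -((1 - Complex.exp (2 * θ * Complex.I)) * (inner ℂ v x / (‖v‖ : ℂ) ^ 2)) := by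
  have hv1 : (‖v‖ : ℂ) ≠ 0 := by simpa using hv
  have hv2 : ‖v‖ ≠ 0 := by simpa using hv
  have h1 := norm_add_sq (𝕜 := ℂ) x (c • v)
  rw [h, norm_smul, inner_smul_right] at h1
  have h2 : 2 * (c * inner ℂ x v).re + (‖c‖ * ‖v‖) ^ 2 = 0 := by
    simp only [RCLike.re_eq_complex_re] at h1
    linarith
  set s := inner ℂ v x with hs
  have hxs : inner ℂ x v = conj s := (inner_conj_symm _ _).symm
  rw [hxs] at h2
  have hs0 : s ≠ 0 := by
    intro h0
    rw [h0] at h2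
    simp at h2
    tauto
  -- The only possible value of `exp (2iθ)`. The condition on the norms says exactly that it has
  -- modulus one.
  set ω : ℂ := 1 + c * (‖v‖ : ℂ) ^ 2 / s with hω
  have hωs : ω * s = s + c * (‖v‖ : ℂ) ^ 2 := by
    rw [hω]; field_simp
  have hω1 : ‖ω‖ = 1 := by
    have h3 : Complex.normSq (ω * s) = Complex.normSq s := by
      rw [hωs, Complex.normSq_add]
      have h5 : Complex.normSq (c * (‖v‖ : ℂ) ^ 2) = ‖v‖ ^ 2 * (‖c‖ * ‖v‖) ^ 2 := by
        rw [Complex.normSq_eq_norm_sq]; simp; ring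
      have h6 : (s * conj (c * (‖v‖ : ℂ) ^ 2)).re = ‖v‖ ^ 2 * (c * conj s).re := by
        have : s * conj (c * (‖v‖ : ℂ) ^ 2) = ((‖v‖ ^ 2 : ℝ) : ℂ) * (conj (c * conj s)) := by
          simp; ring
        rw [this, Complex.re_ofReal_mul, Complex.conj_re]
      rw [h5, h6]
      linear_combination ‖v‖ ^ 2 * h2
    rw [map_mul, Complex.normSq_eq_norm_sq ω] at h3
    have h4 : Complex.normSq s ≠ 0 := by simpa using hs0
    have h5 : ‖ω‖ ^ 2 = 1 := by
      have := mul_right_cancel₀ h4 (h3.trans (one_mul _).symm)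
      exact this
    exact (pow_eq_one_iff_of_nonneg (norm_nonneg _) two_ne_zero).1 h5
  obtain ⟨η, hη⟩ := (Complex.norm_eq_one_iff ω).1 hω1
  have hexp : Complex.exp (2 * ((η / 2 : ℝ) : ℂ) * Complex.I) = ω := by
    rw [← hη]; congr 1; push_cast; ring
  have hcc : c = -((1 - Complex.exp (2 * ((η / 2 : ℝ) : ℂ) * Complex.I)) * (s / (‖v‖ : ℂ) ^ 2)) := by
    rw [hexp, hω]; field_simp; ring
  refine ⟨η / 2, ?_, hcc⟩
  have h7 := rot_sub_self v (η / 2) x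
  rw [← hs, ← hcc] at h7
  rw [← h7]; abel

/-- The real reflection in the orthogonal complement of `u`. -/
def realRefl (u x : V) : V := x - ((2 * (inner ℂ u x).re / ‖u‖ ^ 2 : ℝ) : ℂ) • u

theorem realRefl_smul {r : ℝ} (hr : r ≠ 0) (u x : V) :
    realRefl ((r : ℂ) • u) x = realRefl u x := by
  by_cases hu : u = 0
  · simp [hu, realRefl]
  have h1 : ‖u‖ ≠ 0 := by simpa using hu
  rw [realRefl, realRefl, smul_smul, inner_smul_left, norm_smul]
  congr 2
  simp only [Complex.conj_ofReal, Complex.re_ofReal_mul, Complex.norm_real, Real.norm_eq_abs,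
    mul_pow, sq_abs]
  rw [← Complex.ofReal_mul]
  congr 1
  field_simp

/-- Along the complex line of `v`, the real reflections of `x` run through the chain in direction
`v`, with the argument of the vector as angle up to a shift. Thus the single map `u ↦ realRefl u x`
describes all chains through `x`, and null sets of the sphere can be compared with null sets of
`ℂⁿ`. -/
theorem rot_eq_realRefl {v x : V} (hvx : inner ℂ v x ≠ 0) (θ : ℝ) :
    rot v θ x = realRefl (Complex.exp (((θ + (Real.pi / 2 + (inner ℂ v x).arg) : ℝ) : ℂ)
      * Complex.I) • v) x := by
  have hv : v ≠ 0 := by rintro rfl; simp at hvx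
  have hv1 : (‖v‖ : ℂ) ≠ 0 := by simpa using hv
  set s := inner ℂ v x with hs
  set E := Complex.exp (((θ + (Real.pi / 2 + s.arg) : ℝ) : ℂ) * Complex.I) with hE
  have hE1 : ‖E‖ = 1 := Complex.norm_exp_ofReal_mul_I _
  have hE2 : E * ‖s‖ = Complex.I * Complex.exp (θ * Complex.I) * s := by
    have h1 : E = Complex.exp (θ * Complex.I) * (Complex.exp (Real.pi / 2 * Complex.I)
        * Complex.exp (s.arg * Complex.I)) := by
      rw [hE, ← Complex.exp_add, ← Complex.exp_add]; congr 1; push_cast; ring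
    rw [Complex.exp_pi_div_two_mul_I] at h1
    have h2 := Complex.norm_mul_exp_arg_mul_I s
    nth_rewrite 2 [← h2]
    rw [h1]; ring
  have hre : (conj E * s).re = -(‖s‖ * Real.sin θ) := by
    have h3 : conj E * s * ‖s‖ = -Complex.I * Complex.exp (-(θ * Complex.I)) * ‖s‖ ^ 2 := by
      have h4 := congrArg conj hE2
      simp only [map_mul, Complex.conj_ofReal, Complex.conj_I, ← Complex.exp_conj] at h4
      have h5 : conj s * s = (‖s‖ : ℂ) ^ 2 := by
        rw [mul_comm, Complex.mul_conj, Complex.normSq_eq_norm_sq]; push_cast; rfl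
      rw [← h5, mul_right_comm, h4, mul_neg]; ring
    have hs0 : (‖s‖ : ℂ) ≠ 0 := by simpa using hvx
    have h6 : conj E * s = -Complex.I * Complex.exp (-(θ * Complex.I)) * ‖s‖ := by
      apply mul_right_cancel₀ hs0; rw [h3]; ring
    have h7 : Complex.exp (-(θ * Complex.I)) = (Real.cos θ : ℂ) - Real.sin θ * Complex.I := by
      rw [← neg_mul, Complex.exp_mul_I, Complex.cos_neg, Complex.sin_neg]; push_cast; ring
    rw [h6, h7]
    simp only [mul_sub, sub_mul, Complex.sub_re, Complex.mul_re, Complex.neg_re, Complex.I_re,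
      Complex.I_im, Complex.neg_im, Complex.mul_im, Complex.ofReal_re, Complex.ofReal_im]
    ring
  rw [rot, realRefl, lineProj, smul_smul, smul_smul, inner_smul_left, norm_smul, hE1, one_mul,
    ← hs, hre, exp_two_mul_sub_one]
  congr 2
  push_cast
  generalize Complex.exp (θ * Complex.I) = e at hE2 ⊢
  field_simp
  linear_combination Complex.sin θ * hE2

end Rotation

/-! ### Null sets of the sphere -/

section Refl

variable {V : Type*} [NormedAddCommGroup V] [InnerProductSpace ℂ V]

theorem norm_realRefl (u x : V) : ‖realRefl u x‖ = ‖x‖ := by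
  by_cases hu : u = 0
  · simp [hu, realRefl]
  have h1 : ‖u‖ ≠ 0 := by simpa using hu
  have h2 := norm_sub_sq (𝕜 := ℂ) x (((2 * (inner ℂ u x).re / ‖u‖ ^ 2 : ℝ) : ℂ) • u)
  rw [inner_smul_right, norm_smul, Complex.norm_real, mul_pow, Real.norm_eq_abs, sq_abs,
    RCLike.re_eq_complex_re, Complex.re_ofReal_mul] at h2
  have h3 : (inner ℂ x u).re = (inner ℂ u x).re := by
    rw [← inner_conj_symm, Complex.conj_re]
  rw [h3] at h2
  have h4 : ‖realRefl u x‖ ^ 2 = ‖x‖ ^ 2 := by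
    rw [realRefl, h2]; field_simp; ring
  exact (sq_eq_sq₀ (norm_nonneg _) (norm_nonneg _)).1 h4

theorem realRefl_sub_smul {x y : V} (hx : ‖x‖ = 1) (hy : ‖y‖ = 1) (hxy : y ≠ x) {t : ℝ}
    (ht : t ≠ 0) :
    realRefl ((t : ℂ) • (y - x)) x = y ∧
      (inner ℂ ((t : ℂ) • (y - x)) x).re = -t * (‖y - x‖ ^ 2 / 2) := by
  have h2 := norm_sub_sq (𝕜 := ℂ) y x
  rw [hx, hy, RCLike.re_eq_complex_re] at h2
  have h1 : (inner ℂ (y - x) x).re = - (‖y - x‖ ^ 2 / 2) := by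
    rw [inner_sub_left, Complex.sub_re, inner_self_eq_norm_sq_to_K, hx, h2]
    simp; ring
  have h3 : ‖y - x‖ ≠ 0 := by rw [norm_ne_zero_iff]; exact sub_ne_zero.2 hxy
  constructor
  · rw [realRefl_smul ht, realRefl, h1]
    have : 2 * -(‖y - x‖ ^ 2 / 2) / ‖y - x‖ ^ 2 = -1 := by field_simp
    rw [this]; simp
  · rw [inner_smul_left, Complex.conj_ofReal, Complex.re_ofReal_mul, h1]; ring

theorem realRefl_sub_self (u x : V) :
    realRefl u x - x = -((2 * (inner ℂ u x).re / ‖u‖ ^ 2 : ℝ) : ℂ) • u := by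
  rw [realRefl]; module

end Refl

theorem ae_comp_continuousLinearEquiv {E : Type*} [NormedAddCommGroup E] [NormedSpace ℝ E]
    [MeasurableSpace E] [BorelSpace E] [FiniteDimensional ℝ E] (μ : Measure E)
    [μ.IsAddHaarMeasure] (L : E ≃L[ℝ] E) {p : E → Prop} (h : ∀ᵐ x ∂μ, p x) :
    ∀ᵐ x ∂μ, p (L x) := by
  have h1 := Measure.addHaar_preimage_continuousLinearEquiv μ L {x | ¬ p x}
  rw [ae_iff] at h ⊢
  rw [h, mul_zero] at h1
  exact h1

section Sphere

variable {n : ℕ}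

instance : IsFiniteMeasure (boundaryMeasure n) := by
  unfold boundaryMeasure; infer_instance

theorem boundaryMeasure_ne_zero (hn : 1 ≤ n) : boundaryMeasure n ≠ 0 := by
  have : NeZero n := ⟨by omega⟩
  exact Measure.toSphere_ne_zero _

/-- The open cone over a subset of the sphere. -/
def sphereCone (N : Set (HypBoundary n)) : Set (EuclideanSpace ℂ (Fin n)) :=
  {w | ∃ y ∈ N, ∃ t : ℝ, 0 < t ∧ w = (t : ℂ) • (y : EuclideanSpace ℂ (Fin n))}

theorem real_smul_eq (t : ℝ) (w : EuclideanSpace ℂ (Fin n)) : t • w = (t : ℂ) • w :=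
  (Complex.coe_smul t w).symm

open scoped Pointwise in
theorem volume_sphereCone_eq_zero {N : Set (HypBoundary n)} (hn : 1 ≤ n)
    (h : boundaryMeasure n N = 0) : volume (sphereCone N) = 0 := by
  obtain ⟨M, hNM, hM, hM0⟩ := exists_measurable_superset_of_null h
  rw [boundaryMeasure, Measure.toSphere_apply' _ hM, mul_eq_zero] at hM0
  have hd : ((Module.finrank ℝ (EuclideanSpace ℂ (Fin n)) : ℕ) : ENNReal) ≠ 0 := by
    rw [finrank_real_of_complex, finrank_euclideanSpace_fin]
    exact_mod_cast (by omega : 2 * n ≠ 0)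
  have hM1 := hM0.resolve_left hd
  -- The spherical measure only sees the cone truncated at radius one. The full cone is covered by
  -- countably many dilates of it.
  refine measure_mono_null (t := ⋃ k : ℕ, ((k : ℝ) + 1) •
    (Set.Ioo (0 : ℝ) 1 • (Subtype.val '' M) : Set (EuclideanSpace ℂ (Fin n)))) ?_
    (measure_iUnion_null fun k => by rw [Measure.addHaar_smul, hM1, mul_zero])
  rintro w ⟨y, hy, t, ht, rfl⟩
  obtain ⟨k, hk⟩ := exists_nat_gt t
  have hk' : (0 : ℝ) < (k : ℝ) + 1 := by positivity
  refine Set.mem_iUnion.2 ⟨k, ?_⟩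
  refine ⟨(t / ((k : ℝ) + 1)) • (y : EuclideanSpace ℂ (Fin n)),
    Set.smul_mem_smul ⟨by positivity, ?_⟩ ⟨y, hNM hy, rfl⟩, ?_⟩
  · rw [div_lt_one hk']; linarith
  · simp only [smul_smul]
    rw [mul_div_cancel₀ _ hk'.ne', real_smul_eq]

theorem boundaryMeasure_eq_zero {N : Set (HypBoundary n)} (hN : MeasurableSet N)
    (h : volume (sphereCone N) = 0) : boundaryMeasure n N = 0 := by
  rw [boundaryMeasure, Measure.toSphere_apply' _ hN, mul_eq_zero]
  right
  refine measure_mono_null ?_ h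
  rintro _ ⟨t, ht, _, ⟨y, hy, rfl⟩, rfl⟩
  exact ⟨y, hy, t, ht.1, real_smul_eq _ _⟩

/-- The real reflection acting on the sphere. -/
def sphereRefl (u : EuclideanSpace ℂ (Fin n)) (x : HypBoundary n) : HypBoundary n :=
  ⟨realRefl u x, by rw [mem_sphere_zero_iff_norm, norm_realRefl, norm_eq_of_mem_sphere]⟩

/-- The complex reflection acting on the sphere. -/
def sphereRot (v : EuclideanSpace ℂ (Fin n)) (θ : ℝ) (x : HypBoundary n) : HypBoundary n :=
  ⟨rot v θ x, by rw [mem_sphere_zero_iff_norm, norm_rot, norm_eq_of_mem_sphere]⟩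

theorem volume_re_inner_eq_zero (x : HypBoundary n) :
    volume {u : EuclideanSpace ℂ (Fin n) | (inner ℂ u (x : EuclideanSpace ℂ (Fin n))).re = 0}
      = 0 := by
  let f : EuclideanSpace ℂ (Fin n) →ₗ[ℝ] ℝ :=
    Complex.reLm ∘ₗ (innerSL ℂ (x : EuclideanSpace ℂ (Fin n))).toLinearMap.restrictScalars ℝ
  have hf : ∀ u, f u = (inner ℂ u (x : EuclideanSpace ℂ (Fin n))).re := by
    intro u
    rw [← inner_conj_symm, Complex.conj_re]
    rfl
  have h1 : (LinearMap.ker f) ≠ ⊤ := by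
    intro h
    have h2 : (x : EuclideanSpace ℂ (Fin n)) ∈ LinearMap.ker f := by rw [h]; trivial
    rw [LinearMap.mem_ker, hf, inner_self_eq_norm_sq_to_K, norm_eq_of_mem_sphere] at h2
    simp at h2
  have h3 := Measure.addHaar_submodule volume (LinearMap.ker f) h1
  convert h3 using 2
  ext u
  simp [← hf]

theorem ae_inner_ne_zero (x : HypBoundary n) :
    ∀ᵐ u : EuclideanSpace ℂ (Fin n), inner ℂ u (x : EuclideanSpace ℂ (Fin n)) ≠ 0 := by
  have h : ∀ᵐ u : EuclideanSpace ℂ (Fin n), (inner ℂ u (x : EuclideanSpace ℂ (Fin n))).re ≠ 0 := by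
    rw [ae_iff]; simpa using volume_re_inner_eq_zero x
  filter_upwards [h] with u hu h0
  rw [h0] at hu
  exact hu rfl

theorem ae_sphereRefl (hn : 1 ≤ n) (x : HypBoundary n) {p : HypBoundary n → Prop}
    (h : ∀ᵐ y ∂(boundaryMeasure n), p y) : ∀ᵐ u, p (sphereRefl u x) := by
  rw [ae_iff] at h ⊢
  have hc := volume_sphereCone_eq_zero hn h
  set C := sphereCone {y | ¬ p y} with hC
  have h0 : ∀ w ∈ C, w ≠ 0 := by
    rintro _ ⟨y, _, t, ht, rfl⟩
    have h1 : (y : EuclideanSpace ℂ (Fin n)) ≠ 0 := ne_zero_of_mem_unit_sphere y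
    have h2 : (t : ℂ) ≠ 0 := by exact_mod_cast ht.ne'
    exact smul_ne_zero h2 h1
  -- If `u` reflects `x` to `y ≠ x`, then `u` is a real multiple of `y - x`. For `t > 0` this map
  -- sends `t y` to `t (y - x)`, and its negative covers the negative multiples. Being
  -- differentiable off the origin, both send the null cone to null sets.
  let f : EuclideanSpace ℂ (Fin n) → EuclideanSpace ℂ (Fin n) :=
    fun w => w - ‖w‖ • (x : EuclideanSpace ℂ (Fin n))
  have hf : DifferentiableOn ℝ f C := fun w hw =>
    (differentiableAt_id.sub ((DifferentiableAt.norm ℝ differentiableAt_id (h0 w hw)).smul_const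
      _)).differentiableWithinAt
  have h1 := addHaar_image_eq_zero_of_differentiableOn_of_addHaar_eq_zero volume hf hc
  have h2 := addHaar_image_eq_zero_of_differentiableOn_of_addHaar_eq_zero volume hf.neg hc
  refine measure_mono_null ?_ (measure_union_null (measure_union_null h1 h2)
    (volume_re_inner_eq_zero x))
  intro u hu
  by_cases hre : (inner ℂ u (x : EuclideanSpace ℂ (Fin n))).re = 0
  · exact Or.inr hre
  left
  have hu0 : ‖u‖ ≠ 0 := by
    rw [norm_ne_zero_iff]; rintro rfl; simp at hre
  set c : ℝ := (inner ℂ u (x : EuclideanSpace ℂ (Fin n))).re with hcdef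
  have hs := realRefl_sub_self u (x : EuclideanSpace ℂ (Fin n))
  rw [← hcdef] at hs
  set y := sphereRefl u x with hy
  have hyc : realRefl u (x : EuclideanSpace ℂ (Fin n)) = y := rfl
  rw [hyc] at hs
  have hut : u = ((-(‖u‖ ^ 2 / (2 * c)) : ℝ) : ℂ) •
      ((y : EuclideanSpace ℂ (Fin n)) - x) := by
    rw [hs, smul_smul, ← Complex.ofReal_neg, ← Complex.ofReal_mul]
    have : -(‖u‖ ^ 2 / (2 * c)) * -(2 * c / ‖u‖ ^ 2) = 1 := by field_simp
    rw [this, Complex.ofReal_one, one_smul]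
  set t : ℝ := -(‖u‖ ^ 2 / (2 * c)) with ht
  have hny : ‖(y : EuclideanSpace ℂ (Fin n))‖ = 1 := norm_eq_of_mem_sphere y
  have key : ∀ s : ℝ, 0 < s → f ((s : ℂ) • y) = (s : ℂ) • ((y : EuclideanSpace ℂ (Fin n)) - x) := by
    intro s hs
    simp only [f, norm_smul, hny, mul_one, Complex.norm_real, Real.norm_eq_abs, abs_of_pos hs,
      smul_sub]
    rw [real_smul_eq]
  have ht0 : t ≠ 0 := by
    rw [ht, neg_ne_zero]; positivity
  rcases lt_or_gt_of_ne ht0 with htn | htp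
  · right
    refine ⟨((-t : ℝ) : ℂ) • y, ⟨y, hu, -t, by linarith, rfl⟩, ?_⟩
    rw [Pi.neg_apply, key _ (by linarith), hut]
    push_cast
    rw [neg_smul, neg_neg]
  · left
    exact ⟨(t : ℂ) • y, ⟨y, hu, t, htp, rfl⟩, by rw [key t htp, ← hut]⟩

theorem ae_of_ae_sphereRefl (x : HypBoundary n) {p : HypBoundary n → Prop}
    (hp : MeasurableSet {y | p y}) (h : ∀ᵐ u, p (sphereRefl u x)) :
    ∀ᵐ y ∂(boundaryMeasure n), p y := by
  rw [ae_iff] at h ⊢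
  refine boundaryMeasure_eq_zero hp.compl ?_
  set D : Set (EuclideanSpace ℂ (Fin n)) := {u | ¬ p (sphereRefl u x)} ∩
    {u | (inner ℂ u (x : EuclideanSpace ℂ (Fin n))).re ≠ 0} with hD
  have hD0 : volume D = 0 := measure_mono_null Set.inter_subset_left h
  -- Inverse of the map `t y ↦ t (y - x)`: at `u = t (y - x)` the coefficient of `x` equals `-t`.
  -- Only the ray of `y = x` is missed, and it lies in a null real line.
  let g : EuclideanSpace ℂ (Fin n) → EuclideanSpace ℂ (Fin n) :=
    fun u => u - (‖u‖ ^ 2 / (2 * (inner ℂ u (x : EuclideanSpace ℂ (Fin n))).re)) •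
      (x : EuclideanSpace ℂ (Fin n))
  have hg : DifferentiableOn ℝ g D := by
    intro u hu
    have hu1 : 2 * (inner ℂ u (x : EuclideanSpace ℂ (Fin n))).re ≠ 0 := mul_ne_zero two_ne_zero hu.2
    have hi : DifferentiableAt ℝ (fun u : EuclideanSpace ℂ (Fin n) =>
        inner ℂ u (x : EuclideanSpace ℂ (Fin n))) u :=
      differentiableAt_id.inner ℂ (differentiableAt_const _)
    have hi2 : DifferentiableAt ℝ (fun u : EuclideanSpace ℂ (Fin n) =>
        (inner ℂ u (x : EuclideanSpace ℂ (Fin n))).re) u :=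
      Complex.reCLM.differentiableAt.comp u hi
    have hn2 : DifferentiableAt ℝ (fun u : EuclideanSpace ℂ (Fin n) => ‖u‖ ^ 2) u :=
      differentiableAt_id.norm_sq ℝ
    have hi3 : DifferentiableAt ℝ (fun u : EuclideanSpace ℂ (Fin n) =>
        2 * (inner ℂ u (x : EuclideanSpace ℂ (Fin n))).re) u := hi2.const_mul 2
    have hq : DifferentiableAt ℝ (fun u : EuclideanSpace ℂ (Fin n) =>
        ‖u‖ ^ 2 / (2 * (inner ℂ u (x : EuclideanSpace ℂ (Fin n))).re)) u := by
      simp only [div_eq_mul_inv]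
      exact hn2.mul (hi3.inv hu1)
    exact (differentiableAt_id.sub (hq.smul_const _)).differentiableWithinAt
  have h1 := addHaar_image_eq_zero_of_differentiableOn_of_addHaar_eq_zero volume hg hD0
  have hx0 : (x : EuclideanSpace ℂ (Fin n)) ≠ 0 := ne_zero_of_mem_unit_sphere x
  have h2 : volume ((Submodule.span ℝ {(x : EuclideanSpace ℂ (Fin n))} :
      Submodule ℝ (EuclideanSpace ℂ (Fin n))) : Set (EuclideanSpace ℂ (Fin n))) = 0 := by
    refine Measure.addHaar_submodule _ _ fun htop => ?_
    have h3 : Complex.I • (x : EuclideanSpace ℂ (Fin n)) ∈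
      Submodule.span ℝ {(x : EuclideanSpace ℂ (Fin n))} := by rw [htop]; trivial
    obtain ⟨r, hr⟩ := Submodule.mem_span_singleton.1 h3
    rw [real_smul_eq, ← sub_eq_zero, ← sub_smul, smul_eq_zero] at hr
    have h4 := congrArg Complex.im (hr.resolve_right hx0)
    simp at h4
  refine measure_mono_null ?_ (measure_union_null h1 h2)
  rintro _ ⟨y, hy, t, ht, rfl⟩
  by_cases hyx : y = x
  · right
    rw [hyx, ← real_smul_eq]
    exact Submodule.smul_mem _ _ (Submodule.mem_span_singleton_self _)
  left
  have hyx' : (y : EuclideanSpace ℂ (Fin n)) ≠ x := fun h => hyx (Subtype.ext h)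
  obtain ⟨h3, h4⟩ := realRefl_sub_smul (norm_eq_of_mem_sphere x) (norm_eq_of_mem_sphere y) hyx'
    ht.ne'
  have h5 : ‖(y : EuclideanSpace ℂ (Fin n)) - x‖ ≠ 0 := by
    rw [norm_ne_zero_iff]; exact sub_ne_zero.2 hyx'
  refine ⟨(t : ℂ) • ((y : EuclideanSpace ℂ (Fin n)) - x), ⟨?_, ?_⟩, ?_⟩
  · have : sphereRefl ((t : ℂ) • ((y : EuclideanSpace ℂ (Fin n)) - (x : EuclideanSpace ℂ (Fin n)))) x
        = y := Subtype.ext h3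
    change ¬ p _
    rw [this]; exact hy
  · change (inner ℂ _ _).re ≠ 0
    rw [h4]
    have := ht.ne'
    simp only [ne_eq, neg_mul, neg_eq_zero]
    positivity
  · simp only [g]
    rw [h4, norm_smul, Complex.norm_real, Real.norm_eq_abs, abs_of_pos ht]
    have : (t * ‖(y : EuclideanSpace ℂ (Fin n)) - x‖) ^ 2 /
        (2 * (-t * (‖(y : EuclideanSpace ℂ (Fin n)) - x‖ ^ 2 / 2))) = -t := by
      field_simp
    rw [this, real_smul_eq]
    push_cast
    module

end Sphere

/-! ### Random points of random chains -/

section Sphere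

variable {n : ℕ}

@[fun_prop]
theorem measurable_sphereRot {Ω : Type*} [MeasurableSpace Ω] {f : Ω → EuclideanSpace ℂ (Fin n)}
    {g : Ω → ℝ} {h : Ω → HypBoundary n} (hf : Measurable f) (hg : Measurable g)
    (hh : Measurable h) : Measurable fun ω => sphereRot (f ω) (g ω) (h ω) := by
  refine Measurable.subtype_mk ?_
  have h1 : Measurable fun ω => (h ω : EuclideanSpace ℂ (Fin n)) := measurable_subtype_coe.comp hh
  have h2 : Measurable fun ω => inner ℂ (f ω) (h ω : EuclideanSpace ℂ (Fin n)) := hf.inner h1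
  unfold rot lineProj
  fun_prop

@[fun_prop]
theorem measurable_sphereRefl (x : HypBoundary n) :
    Measurable fun u : EuclideanSpace ℂ (Fin n) => sphereRefl u x := by
  refine Measurable.subtype_mk ?_
  have h2 : Measurable fun u : EuclideanSpace ℂ (Fin n) =>
    inner ℂ u (x : EuclideanSpace ℂ (Fin n)) := measurable_id.inner measurable_const
  unfold realRefl
  fun_prop

theorem sphereRot_smul {c : ℂ} (hc : c ≠ 0) (v : EuclideanSpace ℂ (Fin n)) (θ : ℝ)
    (x : HypBoundary n) : sphereRot (c • v) θ x = sphereRot v θ x :=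
  Subtype.ext (rot_smul_left hc v θ x)

theorem sphereRot_sphereRot (v : EuclideanSpace ℂ (Fin n)) (θ θ' : ℝ) (x : HypBoundary n) :
    sphereRot v θ (sphereRot v θ' x) = sphereRot v (θ + θ') x :=
  Subtype.ext (rot_rot v θ θ' x)

theorem exists_sphereRot_sub_eq {v : EuclideanSpace ℂ (Fin n)} {x : HypBoundary n}
    (hv : inner ℂ v (x : EuclideanSpace ℂ (Fin n)) ≠ 0) {θ : ℝ} (hθ : Real.sin θ ≠ 0) :
    ∃ c : ℂ, c ≠ 0 ∧
      (sphereRot v θ x : EuclideanSpace ℂ (Fin n)) - (x : EuclideanSpace ℂ (Fin n)) = c • v := by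
  refine ⟨_, ?_, rot_sub_self v θ x⟩
  have hv0 : v ≠ 0 := by rintro rfl; simp at hv
  have h1 : (‖v‖ : ℂ) ≠ 0 := by simpa using hv0
  exact neg_ne_zero.2 (mul_ne_zero (exp_two_mul_ne_one hθ) (div_ne_zero hv (pow_ne_zero _ h1)))

/-- Multiplication by a nonzero complex number as a real linear automorphism. -/
def smulEquiv {V : Type*} [NormedAddCommGroup V] [NormedSpace ℂ V] [NormedSpace ℝ V]
    [IsScalarTower ℝ ℂ V] {c : ℂ} (hc : c ≠ 0) : V ≃L[ℝ] V :=
  (ContinuousLinearEquiv.smulLeft (R₁ := ℂ) (M₁ := V) (Units.mk0 c hc)).restrictScalars ℝ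

theorem smulEquiv_apply {V : Type*} [NormedAddCommGroup V] [NormedSpace ℂ V] [NormedSpace ℝ V]
    [IsScalarTower ℝ ℂ V] {c : ℂ} (hc : c ≠ 0) (v : V) : smulEquiv hc v = c • v := rfl

/-- Multiplication by a phase preserves null sets, so a random phase may be inserted by Fubini.
Conversely, one good phase suffices. -/
theorem ae_ae_exp_smul {q : EuclideanSpace ℂ (Fin n) → Prop} (hq : MeasurableSet {u | q u}) :
    (∀ᵐ u, q u) ↔ ∀ᵐ v, ∀ᵐ α : ℝ, q (Complex.exp (α * Complex.I) • v) := by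
  have hm : MeasurableSet {z : EuclideanSpace ℂ (Fin n) × ℝ |
      q (Complex.exp (z.2 * Complex.I) • z.1)} := by
    have : Measurable fun z : EuclideanSpace ℂ (Fin n) × ℝ =>
      Complex.exp (z.2 * Complex.I) • z.1 := by fun_prop
    exact this hq
  rw [Measure.ae_ae_comm (p := fun v (α : ℝ) => q (Complex.exp (α * Complex.I) • v)) hm]
  constructor
  · intro h
    refine Eventually.of_forall fun α => ?_
    exact ae_comp_continuousLinearEquiv volume (smulEquiv (Complex.exp_ne_zero (α * Complex.I))) h
  · intro h
    obtain ⟨α, hα⟩ := h.exists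
    have h1 := ae_comp_continuousLinearEquiv volume
      (smulEquiv (Complex.exp_ne_zero (-(α * Complex.I)))) hα
    filter_upwards [h1] with u hu
    rwa [smulEquiv_apply, smul_smul, ← Complex.exp_add, add_neg_cancel, Complex.exp_zero,
      one_smul] at hu

theorem sphereRot_eq_sphereRefl {v : EuclideanSpace ℂ (Fin n)} {x : HypBoundary n}
    (hv : inner ℂ v (x : EuclideanSpace ℂ (Fin n)) ≠ 0) :
    ∃ c : ℝ, ∀ θ : ℝ, sphereRot v θ x
      = sphereRefl (Complex.exp (((c + θ : ℝ) : ℂ) * Complex.I) • v) x := by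
  refine ⟨Real.pi / 2 + (inner ℂ v (x : EuclideanSpace ℂ (Fin n))).arg, fun θ => ?_⟩
  rw [add_comm]
  exact Subtype.ext (rot_eq_realRefl hv θ)

/-- Together with its converse `ae_of_ae_sphereRot`, this disintegrates the measure class of the
sphere along the chains through `x`. The phase of a random reflecting vector becomes the angle on
the chain, up to a shift depending on `v`. -/
theorem ae_sphereRot (hn : 1 ≤ n) (x : HypBoundary n) {p : HypBoundary n → Prop}
    (h : ∀ᵐ y ∂(boundaryMeasure n), p y) : ∀ᵐ v, ∀ᵐ θ : ℝ, p (sphereRot v θ x) := by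
  obtain ⟨M, hM, hMm, hM0⟩ := exists_measurable_superset_of_null (ae_iff.1 h)
  have h1 : ∀ᵐ y ∂(boundaryMeasure n), y ∈ Mᶜ := by rw [ae_iff]; simpa using hM0
  have h2 := ae_sphereRefl hn x h1
  rw [ae_ae_exp_smul (q := fun u => sphereRefl u x ∈ Mᶜ)
    (measurable_sphereRefl x hMm.compl)] at h2
  filter_upwards [h2, ae_inner_ne_zero x] with v hv hvx
  obtain ⟨c, hc⟩ := sphereRot_eq_sphereRefl hvx
  filter_upwards [ae_of_ae_translate volume c hv] with θ hθ
  rw [← hc] at hθ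
  by_contra hp
  exact hθ (hM hp)

theorem ae_of_ae_sphereRot (x : HypBoundary n) {p : HypBoundary n → Prop}
    (hp : MeasurableSet {y | p y}) (h : ∀ᵐ v, ∀ᵐ θ : ℝ, p (sphereRot v θ x)) :
    ∀ᵐ y ∂(boundaryMeasure n), p y := by
  refine ae_of_ae_sphereRefl x hp ?_
  rw [ae_ae_exp_smul (q := fun u => p (sphereRefl u x)) (measurable_sphereRefl x hp)]
  filter_upwards [h, ae_inner_ne_zero x] with v hv hvx
  obtain ⟨c, hc⟩ := sphereRot_eq_sphereRefl hvx
  filter_upwards [ae_of_ae_translate volume (-c) hv] with θ hθ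
  rwa [hc, add_neg_cancel_left] at hθ

/-- The chain is now indexed by a second point `y` instead of a direction: `y - x` is a nonzero
multiple of `v`, and the reflections depend only on the complex line of `v`. -/
theorem ae_ae_sphereRot_sub (x : HypBoundary n) {p : HypBoundary n → HypBoundary n → Prop}
    (hp : MeasurableSet {y : HypBoundary n × HypBoundary n | p y.1 y.2})
    (h : ∀ᵐ v, ∀ᵐ θ : ℝ, ∀ᵐ θ' : ℝ, p (sphereRot v θ x) (sphereRot v θ' x)) :
    ∀ᵐ y ∂(boundaryMeasure n), ∀ᵐ θ' : ℝ, p y (sphereRot ((y : EuclideanSpace ℂ (Fin n)) -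
      (x : EuclideanSpace ℂ (Fin n))) θ' x) := by
  refine ae_of_ae_sphereRot x ?_ ?_
  · refine measurableSet_ae volume ?_
    have : Measurable fun z : HypBoundary n × ℝ => (z.1, sphereRot
      ((z.1 : EuclideanSpace ℂ (Fin n)) - (x : EuclideanSpace ℂ (Fin n))) z.2 x) := by
      fun_prop
    exact this hp
  · filter_upwards [h, ae_inner_ne_zero x] with v hv hvx
    filter_upwards [hv, ae_sin_ne_zero] with θ hθ hs
    obtain ⟨c, hc, hcv⟩ := exists_sphereRot_sub_eq hvx hs
    rw [hcv]
    simpa only [sphereRot_smul hc] using hθ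

theorem ae_comp_sphereRot (v : EuclideanSpace ℂ (Fin n)) (θ : ℝ) (hn : 1 ≤ n)
    {p : HypBoundary n → Prop} (h : ∀ᵐ y ∂(boundaryMeasure n), p y) :
    ∀ᵐ y ∂(boundaryMeasure n), p (sphereRot v θ y) := by
  obtain ⟨M, hM, hMm, hM0⟩ := exists_measurable_superset_of_null (ae_iff.1 h)
  have h1 : boundaryMeasure n ((fun y => sphereRot v θ y) ⁻¹' M) = 0 := by
    refine boundaryMeasure_eq_zero ((by fun_prop : Measurable fun y => sphereRot v θ y) hMm) ?_
    have h2 := volume_sphereCone_eq_zero hn hM0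
    let L : EuclideanSpace ℂ (Fin n) ≃L[ℝ] EuclideanSpace ℂ (Fin n) :=
      (rotEquiv v θ).toContinuousLinearEquiv.restrictScalars ℝ
    have h3 := Measure.addHaar_preimage_continuousLinearEquiv volume L (sphereCone M)
    rw [h2, mul_zero] at h3
    refine measure_mono_null ?_ h3
    rintro _ ⟨y, hy, t, ht, rfl⟩
    refine ⟨sphereRot v θ y, hy, t, ht, ?_⟩
    exact (rotEquiv v θ).map_smul (t : ℂ) (y : EuclideanSpace ℂ (Fin n))
  rw [ae_iff]
  exact measure_mono_null (fun y hy => hM (a := sphereRot v θ y) hy) h1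

/-- The arc length measure of a chain is absolutely continuous in the angle. -/
theorem ae_angle_of_hausdorffMeasure {v : EuclideanSpace ℂ (Fin n)} {x : HypBoundary n}
    (hv : inner ℂ v (x : EuclideanSpace ℂ (Fin n)) ≠ 0) {N : Set (HypBoundary n)}
    (hN : μH[1] N = 0) : ∀ᵐ θ : ℝ, sphereRot v θ x ∉ N := by
  set P := lineProj v (x : EuclideanSpace ℂ (Fin n)) with hP
  have hP0 : 0 < ‖P‖ := by
    rw [norm_pos_iff, hP, lineProj]
    have hv0 : v ≠ 0 := by rintro rfl; simp at hv
    have h1 : (‖v‖ : ℂ) ≠ 0 := by simpa using hv0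
    exact smul_ne_zero (div_ne_zero hv (pow_ne_zero _ h1)) hv0
  have hdist : ∀ θ θ' : ℝ, dist (sphereRot v θ x) (sphereRot v θ' x)
      = 2 * |Real.sin (θ - θ')| * ‖P‖ := by
    intro θ θ'
    rw [Subtype.dist_eq, dist_eq_norm]
    have h1 : (sphereRot v θ x : EuclideanSpace ℂ (Fin n)) -
        (sphereRot v θ' x : EuclideanSpace ℂ (Fin n)) =
        (-(Complex.exp (2 * θ' * Complex.I) *
          (1 - Complex.exp (2 * ((θ - θ' : ℝ) : ℂ) * Complex.I)))) • P := by
      have h2 : Complex.exp (2 * θ' * Complex.I) * Complex.exp (2 * ((θ - θ' : ℝ) : ℂ) * Complex.I)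
          = Complex.exp (2 * θ * Complex.I) := by
        rw [← Complex.exp_add]; congr 1; push_cast; ring
      rw [mul_sub, h2, mul_one]
      change rot v θ (x : EuclideanSpace ℂ (Fin n)) - rot v θ' (x : EuclideanSpace ℂ (Fin n)) = _
      rw [rot, rot]
      module
    have h3 : ‖Complex.exp (2 * θ' * Complex.I)‖ = 1 := by
      have := Complex.norm_exp_ofReal_mul_I (2 * θ')
      simpa using this
    rw [h1, norm_smul, norm_neg, norm_mul, h3, exp_two_mul_sub_one, norm_neg, norm_mul, norm_mul,
      norm_mul, Complex.norm_exp_ofReal_mul_I, Complex.norm_real]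
    simp
  -- On an interval of length `π/2`, Jordan's inequality `|sin t| ≥ (2/π)|t|` makes the
  -- parametrization antilipschitz, so preimages of null sets for the Hausdorff measure are null.
  have key : ∀ k : ℤ, volume (Set.Icc (k * (Real.pi / 2)) ((k + 1) * (Real.pi / 2)) ∩
      {θ : ℝ | sphereRot v θ x ∈ N}) = 0 := by
    intro k
    set A := Set.Icc ((k : ℝ) * (Real.pi / 2)) ((k + 1) * (Real.pi / 2)) with hA
    let f : A → HypBoundary n := fun θ => sphereRot v θ x
    have hf : AntilipschitzWith (Real.toNNReal (Real.pi / (4 * ‖P‖))) f := by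
      refine AntilipschitzWith.of_le_mul_dist fun a b => ?_
      rw [Real.coe_toNNReal _ (by positivity), hdist, Subtype.dist_eq, Real.dist_eq]
      have h1 : |(a : ℝ) - b| ≤ Real.pi / 2 := by
        have ha := Set.mem_Icc.1 a.2
        have hb := Set.mem_Icc.1 b.2
        rw [abs_le]
        constructor <;> linarith
      have h2 := Real.mul_abs_le_abs_sin h1
      calc |(a : ℝ) - b| = Real.pi / 2 * (2 / Real.pi * |(a : ℝ) - b|) := by
            field_simp
        _ ≤ Real.pi / 2 * |Real.sin (a - b)| := by gcongr
        _ = _ := by field_simp; ring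
    have h1 := hf.hausdorffMeasure_preimage_le zero_le_one N
    rw [hN, mul_zero, nonpos_iff_eq_zero] at h1
    have h2 := (isometry_subtype_coe (s := A)).hausdorffMeasure_image (d := 1)
      (Or.inl zero_le_one) (f ⁻¹' N)
    rw [h1, hausdorffMeasure_real] at h2
    refine measure_mono_null ?_ h2
    rintro θ ⟨hθ, hθN⟩
    exact ⟨⟨θ, hθ⟩, hθN, rfl⟩
  rw [ae_iff]
  refine measure_mono_null ?_ (measure_iUnion_null key)
  intro θ hθ
  have hpi : 0 < Real.pi / 2 := by positivity
  have h1 := Int.floor_le (θ / (Real.pi / 2))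
  have h2 := Int.lt_floor_add_one (θ / (Real.pi / 2))
  rw [le_div_iff₀ hpi] at h1
  rw [div_lt_iff₀ hpi] at h2
  refine Set.mem_iUnion.2 ⟨⌊θ / (Real.pi / 2)⌋, ⟨h1, h2.le⟩, ?_⟩
  simpa using hθ

end Sphere

/-! ### Images of chains -/

theorem HasSignature.finiteDimensional {p a b : ℕ} {E : Submodule ℂ EllTwo}
    (h : HasSignature p E a b) : FiniteDimensional ℂ E := by
  obtain ⟨P, N, rfl, hP, -, hN, -⟩ := h
  infer_instance

theorem HasSignature.finrank_le {p a b : ℕ} {E : Submodule ℂ EllTwo}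
    (h : HasSignature p E a b) : Module.finrank ℂ E ≤ a + b := by
  obtain ⟨P, N, rfl, hP, rfl, hN, rfl, -⟩ := h
  exact Submodule.finrank_add_le_finrank_add_finrank P N

theorem IsotropicSubspace.Transverse.finrank_sup {p : ℕ} {V W : IsotropicSubspace p}
    (h : V.Transverse W) :
    Module.finrank ℂ (V.carrier ⊔ W.carrier : Submodule ℂ EllTwo) = p + p := by
  have := V.finiteDimensional
  have := W.finiteDimensional
  have h1 := Submodule.finrank_sup_add_finrank_inf_eq V.carrier W.carrier
  rw [IsotropicSubspace.Transverse] at h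
  rwa [h, finrank_bot, add_zero, V.finrank_eq, W.finrank_eq] at h1

section Chains

variable {n p : ℕ} {φ : HypBoundary n → IsotropicSubspace p}

theorem ae_exists_of_chain (hn : 1 ≤ n) (hchain : AlmostSurelyMapsChainsToChains φ) :
    ∀ᵐ x ∂(boundaryMeasure n), ∀ᵐ v, ∃ F : Submodule ℂ EllTwo, FiniteDimensional ℂ F ∧
      Module.finrank ℂ F ≤ p + p ∧ ∀ᵐ θ : ℝ, (φ (sphereRot v θ x)).carrier ≤ F := by
  filter_upwards [Measure.ae_ae_of_ae_prod hchain] with x hx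
  filter_upwards [ae_sphereRot hn x hx, ae_inner_ne_zero x] with v hv hvx
  obtain ⟨θ, hθ, hs⟩ := (hv.and ae_sin_ne_zero).exists
  obtain ⟨T, ⟨F, hF, rfl⟩, hT⟩ := hθ
  refine ⟨F, hF.finiteDimensional, hF.finrank_le, ?_⟩
  obtain ⟨c, hc, hcv⟩ := exists_sphereRot_sub_eq hvx hs
  rw [ae_iff] at hT
  -- This inequality for restricted measures holds for arbitrary sets, so no measurability of the
  -- exceptional set is needed.
  have h1 := le_antisymm ((Measure.le_restrict_apply _ _).trans_eq hT) zero_le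
  filter_upwards [ae_angle_of_hausdorffMeasure hvx h1] with θ' hθ'
  by_contra h2
  refine hθ' ⟨h2, ?_⟩
  have h3 := rot_sub_self v θ' (x : EuclideanSpace ℂ (Fin n))
  set d := -((1 - Complex.exp (2 * θ' * Complex.I)) *
    (inner ℂ v (x : EuclideanSpace ℂ (Fin n)) / (‖v‖ : ℂ) ^ 2))
  refine ⟨d / c, ?_⟩
  rw [hcv, smul_smul, div_mul_cancel₀ _ hc, ← h3]
  change rot v θ' (x : EuclideanSpace ℂ (Fin n)) = _
  abel

/-- Transversality for almost every pair of the product is transferred to pairs on one chain: a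
reflection along the chain turns a pair with first point `x` into a pair of two random points. A
measurable null set `M` containing the bad pairs makes Fubini applicable. -/
theorem ae_transverse_sphereRot (hn : 1 ≤ n)
    (htrans : ∀ᵐ xy ∂((boundaryMeasure n).prod (boundaryMeasure n)),
      (φ xy.1).Transverse (φ xy.2)) :
    ∀ᵐ x ∂(boundaryMeasure n), ∀ᵐ v, ∀ᵐ θ : ℝ, ∀ᵐ θ' : ℝ,
      (φ (sphereRot v θ x)).Transverse (φ (sphereRot v θ' x)) := by
  obtain ⟨M, hM, hMm, hM0⟩ := exists_measurable_superset_of_null (ae_iff.1 htrans)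
  have h0 : ∀ᵐ xy ∂((boundaryMeasure n).prod (boundaryMeasure n)), xy ∉ M := by
    rw [ae_iff]; simpa using hM0
  have h1 : ∀ᵐ x ∂(boundaryMeasure n), ∀ᵐ v, ∀ᵐ θ : ℝ, (x, sphereRot v θ x) ∉ M := by
    filter_upwards [Measure.ae_ae_of_ae_prod h0] with x hx
    exact ae_sphereRot hn x hx
  have hmeas : ∀ {Ω : Type} [MeasurableSpace Ω] (f g : Ω → HypBoundary n), Measurable f →
      Measurable g → MeasurableSet {ω | (f ω, g ω) ∉ M} :=
    fun f g hf hg => (hf.prodMk hg) hMm.compl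
  rw [Measure.ae_ae_comm (p := fun x v => ∀ᵐ θ : ℝ, (x, sphereRot v θ x) ∉ M)] at h1
  swap
  · exact measurableSet_ae (p := fun (z : HypBoundary n × EuclideanSpace ℂ (Fin n)) (θ : ℝ) =>
      (z.1, sphereRot z.2 θ z.1) ∉ M) volume (hmeas _ _ (by fun_prop) (by fun_prop))
  have h2 : ∀ᵐ v : EuclideanSpace ℂ (Fin n), ∀ᵐ x ∂(boundaryMeasure n), ∀ᵐ θ : ℝ, ∀ᵐ θ' : ℝ,
      (sphereRot v θ x, sphereRot v θ' x) ∉ M := by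
    filter_upwards [h1] with v hv
    rw [Measure.ae_ae_comm (p := fun x θ => (x, sphereRot v θ x) ∉ M)
      (hmeas _ _ (by fun_prop) (by fun_prop))] at hv
    have h3 : ∀ᵐ θ : ℝ, ∀ᵐ x ∂(boundaryMeasure n), ∀ᵐ θ' : ℝ,
        (sphereRot v θ x, sphereRot v θ' x) ∉ M := by
      refine Eventually.of_forall fun θ => ?_
      rw [Measure.ae_ae_comm (p := fun x θ' => (sphereRot v θ x, sphereRot v θ' x) ∉ M)
        (hmeas _ _ (by fun_prop) (by fun_prop))]
      -- The second angle is shifted by `-θ`, and then `x` is replaced by its image under the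
      -- reflection of angle `θ`.
      filter_upwards [ae_of_ae_translate volume (-θ) hv] with θ' hθ'
      filter_upwards [ae_comp_sphereRot v θ hn hθ'] with x hx
      rwa [sphereRot_sphereRot, neg_add_cancel_comm] at hx
    rwa [Measure.ae_ae_comm] at h3
    exact measurableSet_ae (p := fun (z : ℝ × HypBoundary n) (θ' : ℝ) =>
      (sphereRot v z.1 z.2, sphereRot v θ' z.2) ∉ M) volume
      (hmeas _ _ (by fun_prop) (by fun_prop))
  rw [Measure.ae_ae_comm] at h2
  swap
  · exact measurableSet_ae (p := fun (z : EuclideanSpace ℂ (Fin n) × HypBoundary n) (θ : ℝ) =>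
      ∀ᵐ θ' : ℝ, (sphereRot z.1 θ z.2, sphereRot z.1 θ' z.2) ∉ M) volume
      (measurableSet_ae (p := fun (z : (EuclideanSpace ℂ (Fin n) × HypBoundary n) × ℝ) (θ' : ℝ) =>
      (sphereRot z.1.1 z.2 z.1.2, sphereRot z.1.1 θ' z.1.2) ∉ M) volume
      (hmeas _ _ (by fun_prop) (by fun_prop)))
  filter_upwards [h2] with x hx
  filter_upwards [hx] with v hv
  filter_upwards [hv] with θ hθ
  filter_upwards [hθ] with θ' hθ'
  by_contra h
  exact hθ' (hM h)

theorem measurableSet_le_sup (hφ : Measurable φ) {Ω : Type*} [MeasurableSpace Ω]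
    {f g h : Ω → HypBoundary n} (hf : Measurable f) (hg : Measurable g) (hh : Measurable h) :
    MeasurableSet {ω | (φ (f ω)).carrier ≤ (φ (g ω)).carrier ⊔ (φ (h ω)).carrier} := by
  have h0 := IsotropicSubspace.measurableFamily_carrier p
  exact (h0.comp (hφ.comp hf)).measurableSet_le
    ((h0.comp (hφ.comp hg)).sup (h0.comp (hφ.comp hh)))

/-- Almost every point of almost every chain is mapped into the span of the images of two of its
points. -/
theorem ae_sphereRot_le_sup (hn : 1 ≤ n) (hφ : Measurable φ)
    (hchain : AlmostSurelyMapsChainsToChains φ)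
    (htrans : ∀ᵐ xy ∂((boundaryMeasure n).prod (boundaryMeasure n)),
      (φ xy.1).Transverse (φ xy.2)) :
    ∀ᵐ x ∂(boundaryMeasure n), ∀ᵐ v, ∀ᵐ θ : ℝ, ∀ᵐ θ' : ℝ,
      (φ (sphereRot v θ' x)).carrier ≤ (φ x).carrier ⊔ (φ (sphereRot v θ x)).carrier := by
  have h1 : ∀ᵐ x ∂(boundaryMeasure n), ∀ᵐ v, ∀ᵐ θ : ℝ, ∀ᵐ θ' : ℝ, ∀ᵐ θ'' : ℝ,
      (φ (sphereRot v θ'' x)).carrier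
        ≤ (φ (sphereRot v θ x)).carrier ⊔ (φ (sphereRot v θ' x)).carrier := by
    filter_upwards [ae_exists_of_chain hn hchain, ae_transverse_sphereRot hn htrans] with x hx hx'
    filter_upwards [hx, hx'] with v hv hv'
    obtain ⟨F, hF, hF2, hθF⟩ := hv
    filter_upwards [hv', hθF] with θ hθ hθF1
    filter_upwards [hθ, hθF] with θ' hθ' hθF2
    filter_upwards [hθF] with θ'' hθF3
    -- Two transverse images span dimension `2p`, hence all of the space `F` of the chain.
    rwa [Submodule.eq_of_le_of_finrank_le (sup_le hθF1 hθF2) (by rwa [hθ'.finrank_sup])]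
  rw [Measure.ae_ae_comm] at h1 ⊢
  rotate_left
  · exact measurableSet_ae (p := fun (z : HypBoundary n × EuclideanSpace ℂ (Fin n)) (θ : ℝ) =>
      ∀ᵐ θ' : ℝ, (φ (sphereRot z.2 θ' z.1)).carrier
        ≤ (φ z.1).carrier ⊔ (φ (sphereRot z.2 θ z.1)).carrier) volume
      (measurableSet_ae (p := fun (z : (HypBoundary n × EuclideanSpace ℂ (Fin n)) × ℝ) (θ' : ℝ) =>
      (φ (sphereRot z.1.2 θ' z.1.1)).carrier
        ≤ (φ z.1.1).carrier ⊔ (φ (sphereRot z.1.2 z.2 z.1.1)).carrier) volume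
      (measurableSet_le_sup hφ (by fun_prop) (by fun_prop) (by fun_prop)))
  · exact measurableSet_ae (p := fun (z : HypBoundary n × EuclideanSpace ℂ (Fin n)) (θ : ℝ) =>
      ∀ᵐ θ' : ℝ, ∀ᵐ θ'' : ℝ, (φ (sphereRot z.2 θ'' z.1)).carrier
        ≤ (φ (sphereRot z.2 θ z.1)).carrier ⊔ (φ (sphereRot z.2 θ' z.1)).carrier) volume
      (measurableSet_ae (p := fun (z : (HypBoundary n × EuclideanSpace ℂ (Fin n)) × ℝ) (θ' : ℝ) =>
      ∀ᵐ θ'' : ℝ, (φ (sphereRot z.1.2 θ'' z.1.1)).carrier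
        ≤ (φ (sphereRot z.1.2 z.2 z.1.1)).carrier ⊔ (φ (sphereRot z.1.2 θ' z.1.1)).carrier) volume
      (measurableSet_ae (p := fun (z : ((HypBoundary n × EuclideanSpace ℂ (Fin n)) × ℝ) × ℝ)
        (θ'' : ℝ) => (φ (sphereRot z.1.1.2 θ'' z.1.1.1)).carrier
        ≤ (φ (sphereRot z.1.1.2 z.1.2 z.1.1.1)).carrier ⊔
          (φ (sphereRot z.1.1.2 z.2 z.1.1.1)).carrier) volume
      (measurableSet_le_sup hφ (by fun_prop) (by fun_prop) (by fun_prop))))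
  filter_upwards [h1] with v hv
  rw [Measure.ae_ae_comm] at hv
  swap
  · exact measurableSet_ae (p := fun (z : HypBoundary n × ℝ) (θ' : ℝ) =>
      ∀ᵐ θ'' : ℝ, (φ (sphereRot v θ'' z.1)).carrier
        ≤ (φ (sphereRot v z.2 z.1)).carrier ⊔ (φ (sphereRot v θ' z.1)).carrier) volume
      (measurableSet_ae (p := fun (z : (HypBoundary n × ℝ) × ℝ)
        (θ'' : ℝ) => (φ (sphereRot v θ'' z.1.1)).carrier
        ≤ (φ (sphereRot v z.1.2 z.1.1)).carrier ⊔
          (φ (sphereRot v z.2 z.1.1)).carrier) volume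
      (measurableSet_le_sup hφ (by fun_prop) (by fun_prop) (by fun_prop)))
  -- One angle is good for almost every `x`. Rotating `x` back by it turns the first of the two
  -- spanning points into the base point itself.
  obtain ⟨θ₀, hθ₀⟩ := hv.exists
  filter_upwards [ae_comp_sphereRot v (-θ₀) hn hθ₀] with x hx
  filter_upwards [ae_of_ae_translate volume θ₀ hx] with θ hθ
  filter_upwards [ae_of_ae_translate volume θ₀ hθ] with θ' hθ'
  have h2 : sphereRot v 0 x = x := Subtype.ext (rot_zero v _)
  simpa only [sphereRot_sphereRot, add_neg_cancel_comm, add_neg_cancel, h2] using hθ'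

end Chains

/-! ### Triples of points on a chain, seen from another point -/

/-- In the inverse coordinate `l`, which sends `x` to infinity, the sphere condition is real affine:
for `⟪v, x⟫ ≠ 0`, the chain in direction `v` becomes a real line. -/
theorem norm_add_smul_eq_iff {V : Type*} [NormedAddCommGroup V] [InnerProductSpace ℂ V] {x v : V}
    {l : ℂ} (hl : l ≠ 0) :
    ‖x + l⁻¹ • v‖ = ‖x‖ ↔ 2 * (l * inner ℂ v x).re + ‖v‖ ^ 2 = 0 := by
  have h1 := norm_add_sq (𝕜 := ℂ) x (l⁻¹ • v)
  have h2 : ‖l‖ ≠ 0 := norm_ne_zero_iff.2 hl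
  have h3 : (inner ℂ x (l⁻¹ • v)).re = (l * inner ℂ v x).re / ‖l‖ ^ 2 := by
    rw [inner_smul_right, ← inner_conj_symm x v, Complex.inv_def, Complex.normSq_eq_norm_sq]
    have h4 : conj l * ((‖l‖ ^ 2)⁻¹ : ℝ) * conj (inner ℂ v x)
        = (((‖l‖ ^ 2)⁻¹ : ℝ) : ℂ) * conj (l * inner ℂ v x) := by
      rw [map_mul]; ring
    rw [h4, Complex.re_ofReal_mul, Complex.conj_re]
    field_simp
  rw [norm_smul, norm_inv, RCLike.re_eq_complex_re, h3] at h1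
  rw [← sq_eq_sq₀ (norm_nonneg _) (norm_nonneg x), h1]
  constructor
  · intro h
    field_simp at h
    linarith
  · intro h
    field_simp
    linarith

/-- With the first point fixed, the angles of the second and the third point are two real
parameters, as many as `γ` has. The resulting map to `γ` is differentiable where needed, so it
carries the bad null set to a null set, and it hits every `γ` off a real line. -/
theorem ae_add_smul_of_ae_sphereRot {n : ℕ} (x : HypBoundary n) {v₁ v₂ : EuclideanSpace ℂ (Fin n)}
    (h₁ : inner ℂ v₁ (x : EuclideanSpace ℂ (Fin n)) ≠ 0)
    (h₂ : inner ℂ v₂ (x : EuclideanSpace ℂ (Fin n)) ≠ 0)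
    (hind : ∀ a b : ℂ, a • v₁ + b • v₂ = 0 → a = 0 ∧ b = 0)
    {θ₁ : ℝ} (hθ₁ : Real.sin θ₁ ≠ 0) {q : EuclideanSpace ℂ (Fin n) → Prop}
    (hq : MeasurableSet {u | q u}) (hom : ∀ c : ℂ, c ≠ 0 → ∀ u, q (c • u) → q u)
    (h : ∀ᵐ θ₂ : ℝ, ∀ᵐ θ : ℝ, q ((sphereRot ((sphereRot v₂ θ₂ x : EuclideanSpace ℂ (Fin n)) -
      (sphereRot v₁ θ₁ x : EuclideanSpace ℂ (Fin n))) θ (sphereRot v₁ θ₁ x) :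
        EuclideanSpace ℂ (Fin n)) - (x : EuclideanSpace ℂ (Fin n)))) :
    ∀ᵐ γ : ℂ, q (v₁ + γ • v₂) := by
  obtain ⟨s₁, hs₁, hs₁v⟩ := exists_sphereRot_sub_eq h₁ hθ₁
  set y₁ := sphereRot v₁ θ₁ x with hy₁
  have hyx : (y₁ : EuclideanSpace ℂ (Fin n)) = x + s₁ • v₁ := by rw [← hs₁v]; abel
  -- the second point, the difference and the position of the third point
  let κ : ℂ := inner ℂ v₂ (x : EuclideanSpace ℂ (Fin n)) / (‖v₂‖ : ℂ) ^ 2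
  let s₂ : ℂ → ℂ := fun ζ => -((1 - Complex.exp (2 * (ζ.re : ℂ) * Complex.I)) * κ)
  let w : ℂ → EuclideanSpace ℂ (Fin n) := fun ζ => s₂ ζ • v₂ - s₁ • v₁
  let τ : ℂ → ℂ := fun ζ => -((1 - Complex.exp (2 * (ζ.im : ℂ) * Complex.I)) *
    (inner ℂ (w ζ) (y₁ : EuclideanSpace ℂ (Fin n)) / (‖w ζ‖ : ℂ) ^ 2))
  -- The third point minus `x` is `(1 - τ) s₁ v₁ + τ s₂ v₂`; the quotient of the two coefficients is
  -- `γ`.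
  let F : ℂ → ℂ := fun ζ => τ ζ * s₂ ζ / ((1 - τ ζ) * s₁)
  have hy₂ : ∀ ζ : ℂ, (sphereRot v₂ ζ.re x : EuclideanSpace ℂ (Fin n)) = x + s₂ ζ • v₂ := by
    intro ζ
    have := rot_sub_self v₂ ζ.re (x : EuclideanSpace ℂ (Fin n))
    change rot v₂ ζ.re (x : EuclideanSpace ℂ (Fin n)) = _
    rw [← this]; abel
  have hw : ∀ ζ : ℂ, (sphereRot v₂ ζ.re x : EuclideanSpace ℂ (Fin n)) -
      (y₁ : EuclideanSpace ℂ (Fin n)) = w ζ := by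
    intro ζ; rw [hy₂, hyx]; simp only [w]; abel
  have hz : ∀ ζ : ℂ, (sphereRot (w ζ) ζ.im y₁ : EuclideanSpace ℂ (Fin n)) -
      (x : EuclideanSpace ℂ (Fin n)) = s₁ • v₁ + τ ζ • w ζ := by
    intro ζ
    have := rot_sub_self (w ζ) ζ.im (y₁ : EuclideanSpace ℂ (Fin n))
    rw [sub_eq_iff_eq_add] at this
    change rot (w ζ) ζ.im (y₁ : EuclideanSpace ℂ (Fin n)) - _ = _
    rw [this]
    simp only [hyx, τ]
    abel
  have hae : ∀ᵐ ζ : ℂ, q (s₁ • v₁ + τ ζ • w ζ) := by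
    have hm : MeasurableSet {z : ℝ × ℝ | q ((sphereRot ((sphereRot v₂ z.1 x :
        EuclideanSpace ℂ (Fin n)) - (y₁ : EuclideanSpace ℂ (Fin n))) z.2 y₁ :
        EuclideanSpace ℂ (Fin n)) - (x : EuclideanSpace ℂ (Fin n)))} := by
      have : Measurable fun z : ℝ × ℝ => (sphereRot ((sphereRot v₂ z.1 x :
        EuclideanSpace ℂ (Fin n)) - (y₁ : EuclideanSpace ℂ (Fin n))) z.2 y₁ :
        EuclideanSpace ℂ (Fin n)) - (x : EuclideanSpace ℂ (Fin n)) := by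
        have m₁ : Measurable fun z : ℝ × ℝ => sphereRot v₂ z.1 x := by fun_prop
        have m₂ := (measurable_subtype_coe.comp m₁).sub_const (y₁ : EuclideanSpace ℂ (Fin n))
        exact (measurable_subtype_coe.comp (measurable_sphereRot m₂ measurable_snd
          (measurable_const (a := y₁)))).sub_const _
      exact this hq
    have h3 := (Measure.ae_prod_iff_ae_ae (μ := (volume : Measure ℝ)) (ν := (volume : Measure ℝ))
      hm).2 h
    have h4 := Complex.volume_preserving_equiv_real_prod.quasiMeasurePreserving.ae h3
    filter_upwards [h4] with ζ hζ
    rw [← hz, ← hw]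
    exact hζ
  have hline : volume {γ : ℂ | (γ * (inner ℂ v₁ (x : EuclideanSpace ℂ (Fin n)) /
      inner ℂ v₂ (x : EuclideanSpace ℂ (Fin n)))).im = 0} = 0 := by
    set r := inner ℂ v₁ (x : EuclideanSpace ℂ (Fin n)) / inner ℂ v₂ (x : EuclideanSpace ℂ (Fin n))
      with hr
    have hr0 : r ≠ 0 := div_ne_zero h₁ h₂
    let f : ℂ →ₗ[ℝ] ℝ := Complex.imLm ∘ₗ (LinearMap.mulRight ℝ r)
    have h5 : LinearMap.ker f ≠ ⊤ := by
      intro htop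
      have h6 : Complex.I / r ∈ LinearMap.ker f := by rw [htop]; trivial
      rw [LinearMap.mem_ker] at h6
      have h7 : f (Complex.I / r) = (Complex.I / r * r).im := rfl
      rw [h7, div_mul_cancel₀ _ hr0] at h6
      simp at h6
    exact Measure.addHaar_submodule volume _ h5
  let D : Set ℂ := {ζ | ¬ q (s₁ • v₁ + τ ζ • w ζ)} ∩ {ζ | w ζ ≠ 0 ∧ 1 - τ ζ ≠ 0}
  have hD : volume D = 0 := measure_mono_null Set.inter_subset_left (ae_iff.1 hae)
  have hFd : DifferentiableOn ℝ F D := by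
    rintro ζ ⟨-, hw0, hτ⟩
    refine DifferentiableAt.differentiableWithinAt ?_
    have hre : Differentiable ℝ fun ζ : ℂ => (ζ.re : ℂ) :=
      Complex.ofRealCLM.differentiable.comp Complex.reCLM.differentiable
    have him : Differentiable ℝ fun ζ : ℂ => (ζ.im : ℂ) :=
      Complex.ofRealCLM.differentiable.comp Complex.imCLM.differentiable
    have hs : Differentiable ℝ s₂ := by
      simp only [s₂]; fun_prop
    have hwd : Differentiable ℝ w := by
      simp only [w]; fun_prop
    have hi : DifferentiableAt ℝ (fun ζ => inner ℂ (w ζ) (y₁ : EuclideanSpace ℂ (Fin n))) ζ :=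
      hwd.differentiableAt.inner ℂ (differentiableAt_const _)
    have hn : DifferentiableAt ℝ (fun ζ => (‖w ζ‖ : ℂ)) ζ :=
      Complex.ofRealCLM.differentiableAt.comp ζ (hwd.differentiableAt.norm ℝ hw0)
    have hn0 : (‖w ζ‖ : ℂ) ^ 2 ≠ 0 := by
      simpa using hw0
    have hτd : DifferentiableAt ℝ τ ζ := by
      simp only [τ, div_eq_mul_inv]
      exact (DifferentiableAt.mul (by fun_prop) (hi.mul ((hn.pow 2).inv hn0))).neg
    simp only [F, div_eq_mul_inv]
    exact (hτd.mul hs.differentiableAt).mul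
      (((hτd.const_sub 1).mul_const s₁).inv (mul_ne_zero hτ hs₁))
  have hFD := addHaar_image_eq_zero_of_differentiableOn_of_addHaar_eq_zero volume hFd hD
  rw [ae_iff]
  refine measure_mono_null ?_ (measure_union_null hFD hline)
  intro γ hγ
  by_cases hγl : (γ * (inner ℂ v₁ (x : EuclideanSpace ℂ (Fin n)) /
      inner ℂ v₂ (x : EuclideanSpace ℂ (Fin n)))).im = 0
  · exact Or.inr hγl
  left
  have hγ0 : γ ≠ 0 := by rintro rfl; simp at hγl
  have hv₂ : v₂ ≠ 0 := by rintro rfl; simp at h₂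
  set a₁ := inner ℂ v₁ (x : EuclideanSpace ℂ (Fin n)) with ha₁
  set a₂ := inner ℂ v₂ (x : EuclideanSpace ℂ (Fin n)) with ha₂
  have hnx : ‖(x : EuclideanSpace ℂ (Fin n))‖ = 1 := norm_eq_of_mem_sphere x
  have ha₃ : inner ℂ (v₁ + γ • v₂) (x : EuclideanSpace ℂ (Fin n)) = a₁ + conj γ * a₂ := by
    rw [inner_add_left, inner_smul_left]
  have hv₃ : v₁ + γ • v₂ ≠ 0 := by
    intro h0
    have := (hind 1 γ (by rwa [one_smul])).1
    exact one_ne_zero this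
  set l₁ : ℂ := s₁⁻¹ with hl₁
  have hl₁0 : l₁ ≠ 0 := inv_ne_zero hs₁
  -- `T` parametrizes the second chain in inverse coordinates. That the third point lies on the
  -- sphere is a real affine equation in `T`, whose slope is a nonzero multiple of `Im (γ a₁ / a₂)`.
  -- This is why one real line of values `γ` is excluded.
  obtain ⟨T, hT⟩ : ∃ T : ℝ, 2 * ((l₁ + γ * ((-((‖v₂‖ ^ 2 / 2 : ℝ) : ℂ) + T * Complex.I) / a₂)) *
      (a₁ + conj γ * a₂)).re + ‖v₁ + γ • v₂‖ ^ 2 = 0 := by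
    set A := ((l₁ + γ * ((-((‖v₂‖ ^ 2 / 2 : ℝ) : ℂ)) / a₂)) * (a₁ + conj γ * a₂)).re with hA
    set B := (γ * (a₁ / a₂)).im with hB
    refine ⟨(A + ‖v₁ + γ • v₂‖ ^ 2 / 2) / B, ?_⟩
    have h5 : ∀ T : ℝ, (l₁ + γ * ((-((‖v₂‖ ^ 2 / 2 : ℝ) : ℂ) + T * Complex.I) / a₂)) *
        (a₁ + conj γ * a₂) = (l₁ + γ * ((-((‖v₂‖ ^ 2 / 2 : ℝ) : ℂ)) / a₂)) * (a₁ + conj γ * a₂)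
        + ((T : ℝ) : ℂ) * (Complex.I * (γ * (a₁ / a₂) + (Complex.normSq γ : ℂ))) := by
      intro T
      rw [← Complex.mul_conj γ]
      field_simp
      ring
    rw [h5, Complex.add_re, ← hA, Complex.re_ofReal_mul, Complex.I_mul_re, Complex.add_im,
      Complex.ofReal_im, add_zero, ← hB]
    field_simp
    ring
  set l₂ : ℂ := (-((‖v₂‖ ^ 2 / 2 : ℝ) : ℂ) + T * Complex.I) / a₂ with hl₂
  have hl₂a : l₂ * a₂ = -((‖v₂‖ ^ 2 / 2 : ℝ) : ℂ) + T * Complex.I := div_mul_cancel₀ _ h₂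
  have hl₂r : 2 * (l₂ * a₂).re + ‖v₂‖ ^ 2 = 0 := by
    rw [hl₂a]; simp
    norm_cast
    ring
  have hl₂0 : l₂ ≠ 0 := by
    intro h0
    rw [h0] at hl₂r
    simp at hl₂r
    exact hv₂ hl₂r
  set l₃ : ℂ := l₁ + γ * l₂ with hl₃
  have hl₃0 : l₃ ≠ 0 := by
    intro h0
    rw [h0] at hT
    simp only [zero_mul, Complex.zero_re, mul_zero, zero_add] at hT
    exact hv₃ (norm_eq_zero.1 (pow_eq_zero_iff two_ne_zero |>.1 hT))
  obtain ⟨θ₂, hθ₂, hθ₂'⟩ := exists_rot_eq (inv_ne_zero hl₂0) hv₂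
    ((norm_add_smul_eq_iff (x := (x : EuclideanSpace ℂ (Fin n))) hl₂0).2 hl₂r)
  have hw0 : l₂⁻¹ • v₂ - s₁ • v₁ ≠ 0 := by
    intro h0
    refine hs₁ (neg_eq_zero.1 (hind (-s₁) l₂⁻¹ ?_).1)
    rw [← h0]; module
  have hτ0 : γ * l₂ / l₃ ≠ 0 := div_ne_zero (mul_ne_zero hγ0 hl₂0) hl₃0
  -- The relation `l₃ = l₁ + γ l₂` expresses that the three points are collinear; the weights are
  -- `l₁ / l₃` and `γ l₂ / l₃`.
  have hpt : (y₁ : EuclideanSpace ℂ (Fin n)) + (γ * l₂ / l₃) • (l₂⁻¹ • v₂ - s₁ • v₁)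
      = x + l₃⁻¹ • (v₁ + γ • v₂) := by
    have e1 : s₁ - γ * l₂ / l₃ * s₁ = l₃⁻¹ := by
      have : s₁ = l₁⁻¹ := by rw [hl₁, inv_inv]
      rw [this]
      field_simp
      rw [hl₃]; ring
    have e2 : γ * l₂ / l₃ * l₂⁻¹ = l₃⁻¹ * γ := by field_simp
    rw [hyx, smul_sub, smul_smul, smul_smul, e2, smul_add, smul_smul, ← e1]
    module
  have hnpt : ‖(y₁ : EuclideanSpace ℂ (Fin n)) + (γ * l₂ / l₃) • (l₂⁻¹ • v₂ - s₁ • v₁)‖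
      = ‖(y₁ : EuclideanSpace ℂ (Fin n))‖ := by
    rw [hpt, norm_eq_of_mem_sphere y₁]
    exact ((norm_add_smul_eq_iff hl₃0).2 (by rw [ha₃]; exact hT)).trans hnx
  obtain ⟨θ, hθ, hθ'⟩ := exists_rot_eq hτ0 hw0 hnpt
  have es₂ : s₂ (θ₂ + θ * Complex.I) = l₂⁻¹ := by
    rw [hθ₂']; simp [s₂, κ]
  have ew : w (θ₂ + θ * Complex.I) = l₂⁻¹ • v₂ - s₁ • v₁ := by
    simp only [w, es₂]
  have eτ : τ (θ₂ + θ * Complex.I) = γ * l₂ / l₃ := by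
    rw [hθ', ← ew]; simp [τ]
  have e1τ : 1 - γ * l₂ / l₃ = l₁ / l₃ := by
    field_simp; rw [hl₃]; ring
  have eF : F (θ₂ + θ * Complex.I) = γ := by
    simp only [F, es₂, eτ, e1τ]
    rw [hl₁]
    field_simp
  refine ⟨θ₂ + θ * Complex.I, ⟨?_, ?_, ?_⟩, eF⟩
  · intro hqq
    refine hγ (hom l₃⁻¹ (inv_ne_zero hl₃0) _ ?_)
    rw [eτ, ew] at hqq
    convert hqq using 1
    have := hpt
    rw [hyx, add_assoc] at this
    exact (add_left_cancel this).symm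
  · rw [ew]; exact hw0
  · rw [eτ, e1τ]; exact div_ne_zero hl₁0 hl₃0

/-! ### Families of subspaces with the span property on almost every line -/

section LinearFamily

variable {n : ℕ} {ψ : EuclideanSpace ℂ (Fin n) → Submodule ℂ EllTwo}

theorem ae_notMem_span {k : ℕ} (hk : k < n) (v : Fin k → EuclideanSpace ℂ (Fin n)) :
    ∀ᵐ u : EuclideanSpace ℂ (Fin n), u ∉ Submodule.span ℂ (Set.range v) := by
  have h1 : (Submodule.span ℂ (Set.range v)).restrictScalars ℝ ≠ ⊤ := by
    intro h
    rw [Submodule.restrictScalars_eq_top_iff] at h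
    have h2 := finrank_range_le_card (R := ℂ) v
    rw [Set.finrank, h, finrank_top, finrank_euclideanSpace_fin, Fintype.card_fin] at h2
    omega
  rw [ae_iff]
  simpa using Measure.addHaar_submodule volume _ h1

theorem ae_fin_succ {k : ℕ} {p : ℂ → (Fin k → ℂ) → Prop}
    (hp : MeasurableSet {z : ℂ × (Fin k → ℂ) | p z.1 z.2}) (h : ∀ᵐ c, ∀ᵐ a, p c a) :
    ∀ᵐ a : Fin (k + 1) → ℂ, p (a 0) (fun i => a i.succ) := by
  have h1 := (Measure.ae_prod_iff_ae_ae (μ := (volume : Measure ℂ))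
    (ν := (volume : Measure (Fin k → ℂ))) hp).2 h
  exact (volume_preserving_piFinSuccAbove (fun _ : Fin (k + 1) => ℂ) 0).quasiMeasurePreserving.ae h1

/-- The induction adds one direction at a time. The base point `v₀` stays generic, so that the span
property can be applied at the translates `v₀ + ∑ aᵢ vᵢ`, and the new direction is chosen only after
the quantifiers have been exchanged. -/
theorem exists_linearIndependent_le_iSup (hψ : MeasurableFamily ψ)
    (hq : ∀ᵐ v, ∀ᵐ v', ∀ᵐ γ : ℂ, ψ (v + γ • v') ≤ ψ v ⊔ ψ v') (k : ℕ) (hk : k < n) :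
    ∃ v : Fin k → EuclideanSpace ℂ (Fin n), LinearIndependent ℂ v ∧
      ∀ᵐ v₀, ∀ᵐ a : Fin k → ℂ, ψ (v₀ + ∑ i, a i • v i) ≤ ψ v₀ ⊔ ⨆ i, ψ (v i) := by
  induction k with
  | zero => exact ⟨0, linearIndependent_empty_type, by simp⟩
  | succ k ih =>
    obtain ⟨v, hv, hv'⟩ := ih (by omega)
    have hψf := hψ.finiteDimensional
    set W := ⨆ i, ψ (v i) with hW
    let f : (Fin k → ℂ) → EuclideanSpace ℂ (Fin n) := fun a => ∑ i, a i • v i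
    have hf : Measurable f := by simp only [f]; fun_prop
    have h1 : ∀ᵐ a : Fin k → ℂ, ∀ᵐ v₀, ∀ᵐ v', ∀ᵐ γ : ℂ,
        ψ (v₀ + f a + γ • v') ≤ ψ (v₀ + f a) ⊔ ψ v' := by
      refine Eventually.of_forall fun a => ?_
      filter_upwards [ae_of_ae_translate volume (f a) hq] with v₀ hv₀
      simpa only [add_comm (f a)] using hv₀
    rw [Measure.ae_ae_comm] at h1
    swap
    · exact measurableSet_ae (p := fun (z : (Fin k → ℂ) × EuclideanSpace ℂ (Fin n)) v' =>
        ∀ᵐ γ : ℂ, ψ (z.2 + f z.1 + γ • v') ≤ ψ (z.2 + f z.1) ⊔ ψ v') volume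
        (measurableSet_ae (p := fun (z : ((Fin k → ℂ) × EuclideanSpace ℂ (Fin n)) ×
          EuclideanSpace ℂ (Fin n)) (γ : ℂ) =>
          ψ (z.1.2 + f z.1.1 + γ • z.2) ≤ ψ (z.1.2 + f z.1.1) ⊔ ψ z.2) volume
        ((hψ.comp (by fun_prop)).measurableSet_le
          ((hψ.comp (by fun_prop)).sup (hψ.comp (by fun_prop)))))
    have hm : ∀ {Ω : Type} [MeasurableSpace Ω] {f₁ f₂ f₃ : Ω → EuclideanSpace ℂ (Fin n)},
        Measurable f₁ → Measurable f₂ → Measurable f₃ →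
        MeasurableSet {ω | ψ (f₁ ω) ≤ ψ (f₂ ω) ⊔ W ⊔ ψ (f₃ ω)} := fun h₁ h₂ h₃ =>
      (hψ.comp h₁).measurableSet_le
        (((hψ.comp h₂).sup (MeasurableFamily.const W)).sup (hψ.comp h₃))
    have h2 : ∀ᵐ v₀, ∀ᵐ v', ∀ᵐ γ : ℂ, ∀ᵐ a : Fin k → ℂ,
        ψ (v₀ + f a + γ • v') ≤ ψ v₀ ⊔ W ⊔ ψ v' := by
      filter_upwards [h1, hv'] with v₀ hv₀ hv₀'
      have h3 : ∀ᵐ a : Fin k → ℂ, ∀ᵐ v', ∀ᵐ γ : ℂ,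
          ψ (v₀ + f a + γ • v') ≤ ψ v₀ ⊔ W ⊔ ψ v' := by
        filter_upwards [hv₀, hv₀'] with a ha ha'
        filter_upwards [ha] with v' hav'
        filter_upwards [hav'] with γ hγ
        exact hγ.trans (sup_le_sup_right ha' _)
      rw [Measure.ae_ae_comm] at h3
      swap
      · exact measurableSet_ae (p := fun (z : (Fin k → ℂ) × EuclideanSpace ℂ (Fin n)) (γ : ℂ) =>
          ψ (v₀ + f z.1 + γ • z.2) ≤ ψ v₀ ⊔ W ⊔ ψ z.2) volume
          (hm (by fun_prop) (by fun_prop) (by fun_prop))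
      filter_upwards [h3] with v' h4
      rwa [Measure.ae_ae_comm] at h4
      exact hm (by fun_prop) (by fun_prop) (by fun_prop)
    rw [Measure.ae_ae_comm] at h2
    swap
    · exact measurableSet_ae (p := fun (z : EuclideanSpace ℂ (Fin n) × EuclideanSpace ℂ (Fin n))
        (γ : ℂ) => ∀ᵐ a : Fin k → ℂ, ψ (z.1 + f a + γ • z.2) ≤ ψ z.1 ⊔ W ⊔ ψ z.2) volume
        (measurableSet_ae (p := fun (z : (EuclideanSpace ℂ (Fin n) × EuclideanSpace ℂ (Fin n)) × ℂ)
        (a : Fin k → ℂ) => ψ (z.1.1 + f a + z.2 • z.1.2) ≤ ψ z.1.1 ⊔ W ⊔ ψ z.1.2) volume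
        (hm (by fun_prop) (by fun_prop) (by fun_prop)))
    obtain ⟨v', h3, h4⟩ := (h2.and (ae_notMem_span (by omega) v)).exists
    refine ⟨Fin.cons v' v, linearIndependent_finCons.2 ⟨hv, h4⟩, ?_⟩
    filter_upwards [h3] with v₀ h5
    have h6 := ae_fin_succ (p := fun γ a => ψ (v₀ + f a + γ • v') ≤ ψ v₀ ⊔ W ⊔ ψ v')
      (hm (by fun_prop) (by fun_prop) (by fun_prop)) h5
    filter_upwards [h6] with a ha
    have h7 : v₀ + ∑ i, a i • (Fin.cons v' v : Fin (k + 1) → EuclideanSpace ℂ (Fin n)) i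
        = v₀ + f (fun i => a i.succ) + a 0 • v' := by
      rw [Fin.sum_univ_succ]
      simp only [Fin.cons_zero, Fin.cons_succ, f]
      abel
    rw [h7]
    refine ha.trans (sup_le (sup_le le_sup_left ?_) ?_)
    · refine le_sup_of_le_right (iSup_le fun i => ?_)
      exact le_iSup_of_le i.succ (by simp)
    · exact le_sup_of_le_right (le_iSup_of_le 0 (by simp))

theorem exists_ae_le_iSup (hn : 1 ≤ n) (hψ : MeasurableFamily ψ)
    (hom : ∀ c : ℂ, c ≠ 0 → ∀ v, ψ (c • v) = ψ v)
    (hq : ∀ᵐ v, ∀ᵐ v', ∀ᵐ γ : ℂ, ψ (v + γ • v') ≤ ψ v ⊔ ψ v') :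
    ∃ v : Fin n → EuclideanSpace ℂ (Fin n), ∀ᵐ u, ψ u ≤ ⨆ i, ψ (v i) := by
  obtain ⟨k, rfl⟩ : ∃ k, n = k + 1 := ⟨n - 1, by omega⟩
  obtain ⟨v, hv, hv'⟩ := exists_linearIndependent_le_iSup hψ hq k (Nat.lt_succ_self k)
  obtain ⟨v₀, h0, h1⟩ := (hv'.and (ae_notMem_span (Nat.lt_succ_self k) v)).exists
  have hψf := hψ.finiteDimensional
  set W := ψ v₀ ⊔ ⨆ i, ψ (v i) with hW
  have hind := linearIndependent_finCons.2 ⟨hv, h1⟩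
  set v' : Fin (k + 1) → EuclideanSpace ℂ (Fin (k + 1)) := Fin.cons v₀ v with hv'
  have hWle : W ≤ ⨆ i, ψ (v' i) := by
    refine sup_le (le_iSup_of_le 0 (by simp [v'])) (iSup_le fun i => ?_)
    exact le_iSup_of_le i.succ (by simp [v'])
  refine ⟨v', ?_⟩
  -- Homogeneity passes from the affine hyperplane through `v₀` to its multiples by nonzero `c`,
  -- which together fill almost all of `ℂⁿ`.
  have h2 : ∀ᵐ c : ℂ, ∀ᵐ a : Fin k → ℂ, ψ (c • v₀ + ∑ i, a i • v i) ≤ W := by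
    filter_upwards [(Set.countable_singleton (0 : ℂ)).ae_notMem volume] with c hc
    have hc0 : c ≠ 0 := by simpa using hc
    filter_upwards [ae_comp_continuousLinearEquiv volume (smulEquiv (inv_ne_zero hc0)) h0] with a ha
    rw [← hom c hc0] at ha
    convert ha using 2
    rw [smul_add, Finset.smul_sum]
    congr 1
    refine Finset.sum_congr rfl fun i _ => ?_
    rw [smulEquiv_apply, Pi.smul_apply, smul_smul, smul_eq_mul, mul_inv_cancel_left₀ hc0]
  have h3 := ae_fin_succ (p := fun c a => ψ (c • v₀ + ∑ i, a i • v i) ≤ W)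
    ((hψ.comp (by fun_prop)).measurableSet_le (MeasurableFamily.const W)) h2
  let b : Module.Basis (Fin (k + 1)) ℂ (EuclideanSpace ℂ (Fin (k + 1))) :=
    basisOfLinearIndependentOfCardEqFinrank hind (by simp)
  have hb : ⇑b = v' := coe_basisOfLinearIndependentOfCardEqFinrank hind _
  let L : (Fin (k + 1) → ℂ) ≃L[ℝ] EuclideanSpace ℂ (Fin (k + 1)) :=
    (b.equivFun.symm.restrictScalars ℝ).toContinuousLinearEquiv
  have hL : ∀ a, L a = a 0 • v₀ + ∑ i : Fin k, a i.succ • v i := by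
    intro a
    have : L a = ∑ i, a i • b i := b.equivFun_symm_apply a
    rw [this, hb, Fin.sum_univ_succ]
    simp [v']
  have h4 : ∀ᵐ a : Fin (k + 1) → ℂ, ψ (L a) ≤ W := by
    filter_upwards [h3] with a ha
    rwa [hL]
  have := L.isAddHaarMeasure_map (volume : Measure (Fin (k + 1) → ℂ))
  have hac := Measure.absolutelyContinuous_isAddHaarMeasure
    (volume : Measure (EuclideanSpace ℂ (Fin (k + 1))))
    (Measure.map L (volume : Measure (Fin (k + 1) → ℂ)))
  have h5 : ∀ᵐ u ∂(Measure.map L (volume : Measure (Fin (k + 1) → ℂ))), ψ u ≤ W := by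
    rw [ae_map_iff L.continuous.measurable.aemeasurable
      (hψ.measurableSet_le (MeasurableFamily.const W))]
    exact h4
  filter_upwards [hac.ae_le h5] with u hu
  exact hu.trans hWle

end LinearFamily

/-! ### Subspaces of signature `(p, q)` -/

theorem hermForm_add_right (p : ℕ) (x y z : EllTwo) :
    hermForm p x (y + z) = hermForm p x y + hermForm p x z := by
  rw [← hermForm_conj, hermForm_add_left, map_add, hermForm_conj, hermForm_conj]

theorem hermForm_smul_right (p : ℕ) (c : ℂ) (x y : EllTwo) :
    hermForm p x (c • y) = c * hermForm p x y := by
  rw [← hermForm_conj, hermForm_smul_left, map_mul, hermForm_conj, Complex.conj_conj]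

/-- The Hermitian form as a linear functional of its second argument. -/
def hermFunctional (p : ℕ) (x : EllTwo) : EllTwo →ₗ[ℂ] ℂ where
  toFun := hermForm p x
  map_add' := hermForm_add_right p x
  map_smul' c := hermForm_smul_right p c x

theorem hermFunctional_apply (p : ℕ) (x y : EllTwo) : hermFunctional p x y = hermForm p x y := rfl

theorem hermForm_self_neg {p : ℕ} {x : EllTwo} (hx : ∀ i < p, x i = 0) (h0 : x ≠ 0) :
    (hermForm p x x).re < 0 := by
  have h1 : ∑ i ∈ Finset.range p, conj (x i) * x i = 0 :=
    Finset.sum_eq_zero fun i hi => by rw [hx i (Finset.mem_range.1 hi), mul_zero]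
  rw [hermForm_eq, h1, mul_zero, zero_sub, Complex.neg_re, neg_lt_zero]
  have h2 : (inner ℂ x x).re = ‖x‖ ^ 2 := inner_self_eq_norm_sq (𝕜 := ℂ) x
  have := norm_pos_iff.2 h0
  rw [h2]
  positivity

/-- In dimension above `p` some nonzero vector has its first `p` coordinates zero, and there the
form is minus the squared norm. -/
theorem exists_hermForm_self_neg {p : ℕ} (U : Submodule ℂ EllTwo) [FiniteDimensional ℂ U]
    (hU : p < Module.finrank ℂ U) : ∃ u ∈ U, (hermForm p u u).re < 0 := by
  let f : U →ₗ[ℂ] (Fin p → ℂ) :=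
    { toFun := fun u i => (u : EllTwo) i
      map_add' := fun u v => rfl
      map_smul' := fun c u => rfl }
  have h1 : LinearMap.ker f ≠ ⊥ := LinearMap.ker_ne_bot_of_finrank_lt (by simpa using hU)
  obtain ⟨u, hu, hu0⟩ := Submodule.exists_mem_ne_zero_of_ne_bot h1
  refine ⟨u, u.2, hermForm_self_neg (fun i hi => ?_) fun h => hu0 (Subtype.ext h)⟩
  exact congrFun (LinearMap.mem_ker.1 hu) ⟨i, hi⟩

theorem exists_add_smul_hermForm_neg {p : ℕ} {P : Submodule ℂ EllTwo} [FiniteDimensional ℂ P]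
    (hP : Module.finrank ℂ P = p) {y : EllTwo} (hy : y ∉ P) :
    ∃ a ∈ P, ∃ c : ℂ, (hermForm p (a + c • y) (a + c • y)).re < 0 := by
  have h1 : P < P ⊔ Submodule.span ℂ {y} := by
    refine lt_of_le_of_ne le_sup_left fun h => hy ?_
    rw [h]
    exact Submodule.mem_sup_right (Submodule.mem_span_singleton_self y)
  have h2 := Submodule.finrank_lt_finrank_of_lt h1
  rw [hP] at h2
  obtain ⟨u, hu, hu0⟩ := exists_hermForm_self_neg _ h2
  obtain ⟨a, ha, b, hb, rfl⟩ := Submodule.mem_sup.1 hu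
  obtain ⟨c, rfl⟩ := Submodule.mem_span_singleton.1 hb
  exact ⟨a, ha, c, hu0⟩

theorem hermForm_add_smul_self {p : ℕ} {a y : EllTwo} (h : hermForm p a y = 0) (c : ℂ) :
    (hermForm p (a + c • y) (a + c • y)).re
      = (hermForm p a a).re + ‖c‖ ^ 2 * (hermForm p y y).re := by
  have h' : hermForm p y a = 0 := by rw [← hermForm_conj, h, map_zero]
  rw [hermForm_add_left, hermForm_add_right, hermForm_add_right, hermForm_smul_left,
    hermForm_smul_left, hermForm_smul_right, hermForm_smul_right, h, h']
  have h1 : conj c * (c * hermForm p y y) = ((‖c‖ ^ 2 : ℝ) : ℂ) * hermForm p y y := by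
    rw [← mul_assoc, mul_comm (conj c), Complex.mul_conj, Complex.normSq_eq_norm_sq]
  rw [h1]
  simp only [mul_zero, add_zero, zero_add, Complex.add_re, Complex.re_ofReal_mul]

/-- Otherwise `V + ℂ w` would be totally isotropic of dimension `p + 1`. Hence the form pairs
transverse isotropic subspaces perfectly. -/
theorem eq_zero_of_forall_hermForm_eq_zero {p : ℕ} {V W : IsotropicSubspace p}
    (h : V.Transverse W) {w : EllTwo} (hw : w ∈ W.carrier)
    (h0 : ∀ v ∈ V.carrier, hermForm p v w = 0) : w = 0 := by
  by_contra hne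
  have hwV : w ∉ V.carrier := by
    intro hwV
    have : w ∈ V.carrier ⊓ W.carrier := ⟨hwV, hw⟩
    rw [IsotropicSubspace.Transverse] at h
    rw [h] at this
    exact hne this
  have := V.finiteDimensional
  obtain ⟨a, ha, c, hc⟩ := exists_add_smul_hermForm_neg V.finrank_eq hwV
  rw [hermForm_add_smul_self (h0 a ha), V.isotropic a ha a ha, W.isotropic w hw w hw] at hc
  simp at hc

/-- The span of two transverse isotropic subspaces contains a positive definite subspace of the same
dimension. -/
theorem exists_positive_le_sup {p : ℕ} {V W : IsotropicSubspace p} (h : V.Transverse W) :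
    ∃ P ≤ V.carrier ⊔ W.carrier, FiniteDimensional ℂ P ∧ Module.finrank ℂ P = p ∧
      ∀ x ∈ P, x ≠ 0 → 0 < (hermForm p x x).re := by
  have := V.finiteDimensional
  have := W.finiteDimensional
  let e : Module.Basis (Fin p) ℂ V.carrier := Module.finBasisOfFinrankEq ℂ V.carrier V.finrank_eq
  let B : W.carrier →ₗ[ℂ] (Fin p → ℂ) :=
    LinearMap.pi fun i => hermFunctional p (e i) ∘ₗ W.carrier.subtype
  have hB : ∀ w i, B w i = hermForm p (e i) w := fun w i => rfl
  have hBinj : Function.Injective B := by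
    rw [← LinearMap.ker_eq_bot, LinearMap.ker_eq_bot']
    intro w hw
    refine Subtype.ext (eq_zero_of_forall_hermForm_eq_zero h w.2 fun v hv => ?_)
    have h1 : (⟨v, hv⟩ : V.carrier) ∈ Submodule.span ℂ (Set.range e) := by
      rw [e.span_eq]; trivial
    rw [← hermForm_conj, ← hermFunctional_apply]
    have h2 : (hermFunctional p w) ∘ₗ V.carrier.subtype = 0 := by
      refine e.ext fun i => ?_
      have h3 := hB w i
      rw [hw] at h3
      change hermForm p w (e i) = 0
      rw [← hermForm_conj, ← h3]
      simp
    have h3 : hermFunctional p w v = 0 := LinearMap.congr_fun h2 ⟨v, hv⟩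
    rw [h3, map_zero]
  have hBsurj : Function.Surjective B := by
    rwa [← LinearMap.injective_iff_surjective_of_finrank_eq_finrank]
    rw [W.finrank_eq, Module.finrank_fin_fun]
  choose w hw using fun j : Fin p => hBsurj (Pi.single j 1)
  have hew : ∀ i j, hermForm p (e i) (w j) = if i = j then 1 else 0 := by
    intro i j
    rw [← hB, hw, Pi.single_apply]
  -- For a basis `e` of `V` and its dual basis `w` in `W`, the vectors `eⱼ + wⱼ` are orthogonal with
  -- square `2`.
  let g : (Fin p → ℂ) →ₗ[ℂ] EllTwo :=
    Fintype.linearCombination ℂ fun j => (e j : EllTwo) + (w j : EllTwo)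
  have hg : ∀ c, g c = ∑ j, c j • (e j : EllTwo) + ∑ j, c j • (w j : EllTwo) := by
    intro c
    simp only [g, Fintype.linearCombination_apply, smul_add, Finset.sum_add_distrib]
  have hgQ : ∀ c, (hermForm p (g c) (g c)).re = 2 * ∑ j, ‖c j‖ ^ 2 := by
    intro c
    have ha : ∑ j, c j • (e j : EllTwo) ∈ V.carrier :=
      Submodule.sum_mem _ fun j _ => Submodule.smul_mem _ _ (e j).2
    have hb : ∑ j, c j • (w j : EllTwo) ∈ W.carrier :=
      Submodule.sum_mem _ fun j _ => Submodule.smul_mem _ _ (w j).2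
    have h1 : ∀ j, hermForm p (w j) (∑ i, c i • (e i : EllTwo)) = c j := by
      intro j
      rw [← hermFunctional_apply, map_sum]
      simp only [map_smul, hermFunctional_apply, smul_eq_mul]
      have h2 : ∀ i, hermForm p (w j) (e i) = if i = j then 1 else 0 := by
        intro i
        rw [← hermForm_conj, hew]
        split_ifs <;> simp
      simp [h2]
    have h3 : hermForm p (∑ i, c i • (e i : EllTwo)) (∑ j, c j • (w j : EllTwo))
        = ((∑ j, ‖c j‖ ^ 2 : ℝ) : ℂ) := by
      rw [← hermFunctional_apply, map_sum, Complex.ofReal_sum]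
      refine Finset.sum_congr rfl fun j _ => ?_
      rw [map_smul, hermFunctional_apply, ← hermForm_conj, h1, smul_eq_mul, Complex.mul_conj,
        Complex.normSq_eq_norm_sq]
    have h4 : hermForm p (∑ j, c j • (w j : EllTwo)) (∑ i, c i • (e i : EllTwo))
        = ((∑ j, ‖c j‖ ^ 2 : ℝ) : ℂ) := by
      rw [← hermForm_conj, h3, Complex.conj_ofReal]
    rw [hg, hermForm_add_left, hermForm_add_right, hermForm_add_right, V.isotropic _ ha _ ha,
      W.isotropic _ hb _ hb, h3, h4, zero_add, add_zero, Complex.add_re, Complex.ofReal_re]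
    ring
  have hpos : ∀ c, c ≠ 0 → 0 < (hermForm p (g c) (g c)).re := by
    intro c hc
    obtain ⟨j, hj⟩ := Function.ne_iff.1 hc
    rw [hgQ]
    refine mul_pos two_pos (Finset.sum_pos' (fun i _ => sq_nonneg _) ⟨j, Finset.mem_univ _, ?_⟩)
    have : ‖c j‖ ≠ 0 := norm_ne_zero_iff.2 hj
    positivity
  have hginj : Function.Injective g := by
    rw [← LinearMap.ker_eq_bot, LinearMap.ker_eq_bot']
    intro c hc
    by_contra hne
    have h5 := hgQ c
    have h6 := hpos c hne
    rw [hc, ← hermFunctional_apply, map_zero] at h6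
    simp at h6
  refine ⟨LinearMap.range g, ?_, inferInstance, ?_, ?_⟩
  · rintro _ ⟨c, rfl⟩
    rw [hg]
    exact Submodule.add_mem_sup (Submodule.sum_mem _ fun j _ => Submodule.smul_mem _ _ (e j).2)
      (Submodule.sum_mem _ fun j _ => Submodule.smul_mem _ _ (w j).2)
  · rw [LinearMap.finrank_range_of_inj hginj, Module.finrank_fin_fun]
  · rintro _ ⟨c, rfl⟩ h0
    exact hpos c fun h => h0 (by rw [h, map_zero])

theorem not_finiteDimensional_ellTwo : ¬ FiniteDimensional ℂ EllTwo := by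
  intro h
  let b : HilbertBasis ℕ ℂ EllTwo := HilbertBasis.ofRepr (LinearIsometryEquiv.refl ℂ _)
  have h1 := b.orthonormal.linearIndependent
  exact Module.Finite.not_linearIndependent_of_infinite _ h1

theorem exists_le_finrank_eq (W : Submodule ℂ EllTwo) [FiniteDimensional ℂ W] (k : ℕ) :
    ∃ E : Submodule ℂ EllTwo, W ≤ E ∧ FiniteDimensional ℂ E ∧
      Module.finrank ℂ E = Module.finrank ℂ W + k := by
  induction k with
  | zero => exact ⟨W, le_rfl, inferInstance, rfl⟩
  | succ k ih =>
    obtain ⟨E, hWE, hE, hEk⟩ := ih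
    obtain ⟨x, hx⟩ : ∃ x, x ∉ E := by
      by_contra! h
      have h1 : E = ⊤ := Submodule.eq_top_iff'.2 h
      rw [h1] at hE
      exact not_finiteDimensional_ellTwo (Module.finite_def.2 (Module.Finite.iff_fg.1 hE))
    refine ⟨E ⊔ Submodule.span ℂ {x}, hWE.trans le_sup_left, inferInstance, ?_⟩
    have h2 := Submodule.finrank_sup_add_finrank_inf_eq E (Submodule.span ℂ {x})
    have hx0 : x ≠ 0 := by rintro rfl; exact hx E.zero_mem
    have h3 : E ⊓ Submodule.span ℂ {x} = ⊥ := by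
      rw [← disjoint_iff]
      exact (Submodule.disjoint_span_singleton' hx0).2 hx
    rw [h3, finrank_bot, finrank_span_singleton hx0] at h2
    omega

/-- The form is nondegenerate on `P`, so `E` is the sum of `P` and its orthogonal complement in `E`.
A nonzero vector there of nonnegative square would make the form nonnegative on a space of dimension
`p + 1`. -/
theorem hasSignature_of_positive {p q : ℕ} {E P : Submodule ℂ EllTwo} [FiniteDimensional ℂ E]
    (hE : Module.finrank ℂ E = p + q) (hPE : P ≤ E) (hP : Module.finrank ℂ P = p)
    (hpos : ∀ x ∈ P, x ≠ 0 → 0 < (hermForm p x x).re) : HasSignature p E p q := by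
  have hPf : FiniteDimensional ℂ P := Submodule.finiteDimensional_of_le hPE
  let N : Submodule ℂ EllTwo :=
    { carrier := {y | y ∈ E ∧ ∀ x ∈ P, hermForm p x y = 0}
      add_mem' := fun {a b} ha hb => ⟨E.add_mem ha.1 hb.1, fun x hx => by
        rw [hermForm_add_right, ha.2 x hx, hb.2 x hx, add_zero]⟩
      zero_mem' := ⟨E.zero_mem, fun x _ => (hermFunctional p x).map_zero⟩
      smul_mem' := fun c a ha => ⟨E.smul_mem c ha.1, fun x hx => by
        rw [hermForm_smul_right, ha.2 x hx, mul_zero]⟩ }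
  have hNE : N ≤ E := fun y hy => hy.1
  have hNf : FiniteDimensional ℂ N := Submodule.finiteDimensional_of_le hNE
  have hinf : P ⊓ N = ⊥ := by
    rw [eq_bot_iff]
    rintro x ⟨hxP, hxN⟩
    by_contra hx
    have := hpos x hxP hx
    rw [hxN.2 x hxP] at this
    simp at this
  let f : Module.Basis (Fin p) ℂ P := Module.finBasisOfFinrankEq ℂ P hP
  let B : EllTwo →ₗ[ℂ] (Fin p → ℂ) := LinearMap.pi fun i => hermFunctional p (f i)
  have hB0 : ∀ y, B y = 0 → ∀ x ∈ P, hermForm p x y = 0 := by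
    intro y hy x hx
    have h2 : (hermFunctional p y) ∘ₗ P.subtype = 0 := by
      refine f.ext fun i => ?_
      change hermForm p y (f i) = 0
      have h3 : hermForm p (f i) y = 0 := congrFun hy i
      rw [← hermForm_conj, h3, map_zero]
    have h3 : hermForm p y x = 0 := LinearMap.congr_fun h2 ⟨x, hx⟩
    rw [← hermForm_conj, h3, map_zero]
  have hBinj : Function.Injective (B.domRestrict P) := by
    rw [← LinearMap.ker_eq_bot, LinearMap.ker_eq_bot']
    intro y hy
    by_contra hne
    have h1 := hpos y y.2 fun h => hne (Subtype.ext h)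
    rw [hB0 y hy y y.2] at h1
    simp at h1
  have hBsurj : Function.Surjective (B.domRestrict P) := by
    rwa [← LinearMap.injective_iff_surjective_of_finrank_eq_finrank]
    rw [hP, Module.finrank_fin_fun]
  have hsup : P ⊔ N = E := by
    refine le_antisymm (sup_le hPE hNE) fun y hy => ?_
    obtain ⟨x, hx⟩ := hBsurj (B y)
    have h1 : B (y - x) = 0 := by
      rw [map_sub, ← hx]; exact sub_self _
    have h2 : y = x + (y - x) := by abel
    rw [h2]
    exact Submodule.add_mem_sup x.2 ⟨E.sub_mem hy (hPE x.2), hB0 _ h1⟩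
  refine ⟨P, N, hsup, hPf, hP, hNf, ?_, hpos, ?_, fun x hx y hy => hy.2 x hx⟩
  · have h1 := Submodule.finrank_sup_add_finrank_inf_eq P N
    rw [hsup, hinf, finrank_bot, hE, hP] at h1
    omega
  · intro y hy hy0
    have hyP : y ∉ P := by
      intro h
      have : y ∈ P ⊓ N := ⟨h, hy⟩
      rw [hinf] at this
      exact hy0 this
    obtain ⟨a, ha, c, hc⟩ := exists_add_smul_hermForm_neg hP hyP
    rw [hermForm_add_smul_self (hy.2 a ha)] at hc
    have h1 : 0 ≤ (hermForm p a a).re := by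
      by_cases h : a = 0
      · rw [h, ← hermFunctional_apply, map_zero, Complex.zero_re]
      · exact (hpos a ha h).le
    by_contra! h2
    have := mul_nonneg (sq_nonneg ‖c‖) h2
    linarith

theorem exists_hasSignature {p q : ℕ} (W : Submodule ℂ EllTwo) [FiniteDimensional ℂ W]
    (hW : Module.finrank ℂ W ≤ p + q) {V₁ V₂ : IsotropicSubspace p} (h : V₁.Transverse V₂)
    (h₁ : V₁.carrier ≤ W) (h₂ : V₂.carrier ≤ W) :
    ∃ E : Submodule ℂ EllTwo, HasSignature p E p q ∧ W ≤ E := by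
  obtain ⟨P, hP, hPf, hPp, hpos⟩ := exists_positive_le_sup h
  obtain ⟨E, hWE, hE, hEd⟩ := exists_le_finrank_eq W (p + q - Module.finrank ℂ W)
  exact ⟨E, hasSignature_of_positive (by omega) ((hP.trans (sup_le h₁ h₂)).trans hWE) hPp hpos, hWE⟩

/-! ### The span of the image -/

section Image

variable {n p : ℕ} {φ : HypBoundary n → IsotropicSubspace p}

theorem finrank_iSup_fin_le {k d : ℕ} (S : Fin k → Submodule ℂ EllTwo)
    [∀ i, FiniteDimensional ℂ (S i)] (hS : ∀ i, Module.finrank ℂ (S i) ≤ d) :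
    Module.finrank ℂ (⨆ i, S i : Submodule ℂ EllTwo) ≤ k * d := by
  induction k with
  | zero => simp
  | succ k ih =>
    have h1 : ⨆ i, S i = S 0 ⊔ ⨆ i : Fin k, S i.succ := by
      refine le_antisymm (iSup_le fun i => Fin.cases le_sup_left (fun j => ?_) i)
        (sup_le (le_iSup S 0) (iSup_le fun j => le_iSup S j.succ))
      exact le_sup_of_le_right (le_iSup (fun j : Fin k => S j.succ) j)
    rw [h1]
    refine (Submodule.finrank_add_le_finrank_add_finrank _ _).trans ?_
    have h2 := ih (fun j => S j.succ) fun j => hS j.succ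
    have h3 := hS 0
    rw [add_mul, one_mul]
    omega

/-- Almost every point is mapped into a subspace spanned by `n + 1` of the images. -/
theorem exists_finrank_le_ae_le (hn : 1 ≤ n) (hφ : Measurable φ)
    (hchain : AlmostSurelyMapsChainsToChains φ)
    (htrans : ∀ᵐ xy ∂((boundaryMeasure n).prod (boundaryMeasure n)),
      (φ xy.1).Transverse (φ xy.2)) :
    ∃ W : Submodule ℂ EllTwo, FiniteDimensional ℂ W ∧ Module.finrank ℂ W ≤ p + n * p ∧
      ∀ᵐ y ∂(boundaryMeasure n), (φ y).carrier ≤ W := by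
  have hne : (ae (boundaryMeasure n)).NeBot := ae_neBot.2 (boundaryMeasure_ne_zero hn)
  have hM := ae_sphereRot_le_sup hn hφ hchain htrans
  obtain ⟨x, hx⟩ := hM.exists
  have hΦ : MeasurableFamily fun y => (φ y).carrier :=
    (IsotropicSubspace.measurableFamily_carrier p).comp hφ
  have hΦf := hΦ.finiteDimensional
  -- A single angle serves almost all directions, so the span of the image of a chain gets a formula
  -- measurable in `v`. The two inclusions show that almost every other angle gives the same span.
  obtain ⟨θ₀, hθ₀⟩ : ∃ θ₀ : ℝ, ∀ᵐ v, ∀ᵐ θ : ℝ,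
      (φ (sphereRot v θ x)).carrier ≤ (φ x).carrier ⊔ (φ (sphereRot v θ₀ x)).carrier ∧
      (φ (sphereRot v θ₀ x)).carrier ≤ (φ x).carrier ⊔ (φ (sphereRot v θ x)).carrier := by
    have hm : ∀ {Ω : Type} [MeasurableSpace Ω] {f g : Ω → HypBoundary n}, Measurable f →
        Measurable g → MeasurableSet {ω | (φ (f ω)).carrier ≤ (φ x).carrier ⊔ (φ (g ω)).carrier} :=
      fun hf hg => measurableSet_le_sup hφ hf measurable_const hg
    have h1 : ∀ᵐ v, ∀ᵐ θ₀ : ℝ, ∀ᵐ θ : ℝ,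
        (φ (sphereRot v θ x)).carrier ≤ (φ x).carrier ⊔ (φ (sphereRot v θ₀ x)).carrier ∧
        (φ (sphereRot v θ₀ x)).carrier ≤ (φ x).carrier ⊔ (φ (sphereRot v θ x)).carrier := by
      filter_upwards [hx] with v hv
      have hv' := hv
      rw [Measure.ae_ae_comm (hm (by fun_prop) (by fun_prop))] at hv'
      filter_upwards [hv, hv'] with θ₀ h h'
      filter_upwards [h, h'] with θ h2 h3
      exact ⟨h2, h3⟩
    rw [Measure.ae_ae_comm] at h1
    · exact h1.exists
    · exact measurableSet_ae (p := fun (z : EuclideanSpace ℂ (Fin n) × ℝ) (θ : ℝ) =>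
        (φ (sphereRot z.1 θ x)).carrier ≤ (φ x).carrier ⊔ (φ (sphereRot z.1 z.2 x)).carrier ∧
        (φ (sphereRot z.1 z.2 x)).carrier ≤ (φ x).carrier ⊔ (φ (sphereRot z.1 θ x)).carrier) volume
        ((hm (by fun_prop) (by fun_prop)).inter (hm (by fun_prop) (by fun_prop)))
  -- the span of the image of the chain through `x` in direction `v`
  let ψ : EuclideanSpace ℂ (Fin n) → Submodule ℂ EllTwo := fun v =>
    (φ x).carrier ⊔ (φ (sphereRot v θ₀ x)).carrier
  have hψ : MeasurableFamily ψ :=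
    (MeasurableFamily.const _).sup (hΦ.comp (f := fun v => sphereRot v θ₀ x) (by fun_prop))
  have hψf := hψ.finiteDimensional
  have hom : ∀ c : ℂ, c ≠ 0 → ∀ v, ψ (c • v) = ψ v := fun c hc v => by
    simp only [ψ, sphereRot_smul hc]
  have hΦψ : ∀ᵐ (y : HypBoundary n) ∂(boundaryMeasure n), (φ y).carrier ≤
        ψ ((y : EuclideanSpace ℂ (Fin n)) - (x : EuclideanSpace ℂ (Fin n))) ∧
      ψ ((y : EuclideanSpace ℂ (Fin n)) - (x : EuclideanSpace ℂ (Fin n))) ≤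
        (φ x).carrier ⊔ (φ y).carrier := by
    refine ae_of_ae_sphereRot x ?_ ?_
    · exact (hΦ.measurableSet_le (hψ.comp (by fun_prop))).inter
        ((hψ.comp (by fun_prop)).measurableSet_le ((MeasurableFamily.const _).sup hΦ))
    · filter_upwards [hθ₀, ae_inner_ne_zero x] with v hv hvx
      filter_upwards [hv, ae_sin_ne_zero] with θ hθ hs
      obtain ⟨c, hc, hcv⟩ := exists_sphereRot_sub_eq hvx hs
      rw [hcv, hom c hc]
      exact ⟨hθ.1, sup_le le_sup_left hθ.2⟩
  -- For `z` on the chain through `y₁` and `y₂`: `ψ (z - x) ≤ φ x + φ z`, and `φ z ≤ φ y₁ + φ y₂`.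
  have htriple : ∀ᵐ (y₁ : HypBoundary n) ∂(boundaryMeasure n), ∀ᵐ (y₂ : HypBoundary n) ∂(boundaryMeasure n), ∀ᵐ θ : ℝ,
      ψ ((sphereRot ((y₂ : EuclideanSpace ℂ (Fin n)) - (y₁ : EuclideanSpace ℂ (Fin n))) θ y₁ :
        EuclideanSpace ℂ (Fin n)) - (x : EuclideanSpace ℂ (Fin n))) ≤
      ψ ((y₁ : EuclideanSpace ℂ (Fin n)) - (x : EuclideanSpace ℂ (Fin n))) ⊔
      ψ ((y₂ : EuclideanSpace ℂ (Fin n)) - (x : EuclideanSpace ℂ (Fin n))) := by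
    filter_upwards [hM, hΦψ] with y₁ hy₁ hy₁ψ
    refine ae_ae_sphereRot_sub y₁ (p := fun y₂ z =>
      ψ ((z : EuclideanSpace ℂ (Fin n)) - (x : EuclideanSpace ℂ (Fin n))) ≤
      ψ ((y₁ : EuclideanSpace ℂ (Fin n)) - (x : EuclideanSpace ℂ (Fin n))) ⊔
      ψ ((y₂ : EuclideanSpace ℂ (Fin n)) - (x : EuclideanSpace ℂ (Fin n)))) ?_ ?_
    · exact (hψ.comp (by fun_prop)).measurableSet_le
        ((MeasurableFamily.const _).sup (hψ.comp (by fun_prop)))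
    · filter_upwards [hy₁, ae_sphereRot hn y₁ hΦψ] with v hv hv'
      filter_upwards [hv, hv'] with θ hθ hy₂
      filter_upwards [hθ, hv'] with θ' hθ' hz
      refine hz.2.trans (sup_le (le_sup_of_le_left le_sup_left) (hθ'.trans ?_))
      exact sup_le_sup hy₁ψ.1 hy₂.1
  have hq : ∀ᵐ v₁, ∀ᵐ v₂, ∀ᵐ γ : ℂ, ψ (v₁ + γ • v₂) ≤ ψ v₁ ⊔ ψ v₂ := by
    filter_upwards [ae_sphereRot hn x htriple, ae_inner_ne_zero x] with v₁ h₁ hv₁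
    obtain ⟨θ₁, hθ₁, hs₁⟩ := (h₁.and ae_sin_ne_zero).exists
    filter_upwards [ae_sphereRot hn x hθ₁, ae_inner_ne_zero x] with v₂ h₂ hv₂
    by_cases hind : ∀ a b : ℂ, a • v₁ + b • v₂ = 0 → a = 0 ∧ b = 0
    · refine ae_add_smul_of_ae_sphereRot x hv₁ hv₂ hind hs₁ (q := fun u => ψ u ≤ ψ v₁ ⊔ ψ v₂)
        (hψ.measurableSet_le (MeasurableFamily.const _)) (fun c hc u hu => ?_) ?_
      · simpa only [hom c hc] using hu
      · obtain ⟨c₁, hc₁, hcv₁⟩ := exists_sphereRot_sub_eq hv₁ hs₁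
        filter_upwards [h₂, ae_sin_ne_zero] with θ₂ hθ₂ hs₂
        obtain ⟨c₂, hc₂, hcv₂⟩ := exists_sphereRot_sub_eq hv₂ hs₂
        rwa [hcv₁, hcv₂, hom c₁ hc₁, hom c₂ hc₂] at hθ₂
    · -- for dependent vectors the family is constant on the line
      push Not at hind
      obtain ⟨a, b, hab, hne⟩ := hind
      have hv₁0 : v₁ ≠ 0 := by rintro rfl; simp at hv₁
      have hv₂0 : v₂ ≠ 0 := by rintro rfl; simp at hv₂
      have ha : a ≠ 0 := by
        rintro rfl
        rw [zero_smul, zero_add, smul_eq_zero] at hab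
        exact hne rfl (hab.resolve_right hv₂0)
      have hb : b ≠ 0 := by
        rintro rfl
        rw [zero_smul, add_zero, smul_eq_zero] at hab
        exact ha (hab.resolve_right hv₁0)
      have hv₂₁ : v₂ = (-(b⁻¹ * a)) • v₁ := by
        have h3 : b • v₂ = -(a • v₁) := eq_neg_of_add_eq_zero_right hab
        rw [neg_smul, mul_smul, ← smul_neg, ← h3, smul_smul, inv_mul_cancel₀ hb, one_smul]
      filter_upwards [(Set.countable_singleton (b * a⁻¹)).ae_notMem volume] with γ hγ
      have h4 : v₁ + γ • v₂ = (1 - γ * (b⁻¹ * a)) • v₁ := by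
        rw [hv₂₁]; module
      have h5 : 1 - γ * (b⁻¹ * a) ≠ 0 := by
        intro h0
        refine hγ ?_
        rw [Set.mem_singleton_iff]
        field_simp at h0 ⊢
        linear_combination -h0
      rw [h4, hom _ h5]
      exact le_sup_left
  obtain ⟨v, hv⟩ := exists_ae_le_iSup hn hψ hom hq
  -- The common summand `φ x` of all `ψ (v i)` is counted once, which gives `p + np` instead of
  -- `2np`.
  refine ⟨(φ x).carrier ⊔ ⨆ i, (φ (sphereRot (v i) θ₀ x)).carrier, inferInstance, ?_, ?_⟩
  · refine (Submodule.finrank_add_le_finrank_add_finrank _ _).trans ?_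
    rw [(φ x).finrank_eq]
    refine Nat.add_le_add_left ?_ _
    exact finrank_iSup_fin_le _ fun i => (φ (sphereRot (v i) θ₀ x)).finrank_eq.le
  · have hle : ⨆ i, ψ (v i) ≤ (φ x).carrier ⊔ ⨆ i, (φ (sphereRot (v i) θ₀ x)).carrier :=
      iSup_le fun i => sup_le_sup_left (le_iSup (fun i => (φ (sphereRot (v i) θ₀ x)).carrier) i) _
    have h7 : ∀ᵐ (y : HypBoundary n) ∂(boundaryMeasure n),
        ψ ((y : EuclideanSpace ℂ (Fin n)) - (x : EuclideanSpace ℂ (Fin n))) ≤ ⨆ i, ψ (v i) := by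
      refine ae_of_ae_sphereRot x ?_ ?_
      · exact (hψ.comp (by fun_prop)).measurableSet_le (MeasurableFamily.const _)
      · filter_upwards [hv, ae_inner_ne_zero x] with u hu hux
        filter_upwards [ae_sin_ne_zero] with θ hs
        obtain ⟨c, hc, hcv⟩ := exists_sphereRot_sub_eq hux hs
        rwa [hcv, hom c hc]
    filter_upwards [h7, hΦψ] with y hy hyψ
    exact (hyψ.1.trans hy).trans hle

end Image

end

/-! ### Conclusion: the subspace of signature `(p, np)` -/

theorem mainTheorem9 (n p : ℕ) (hn : 1 ≤ n) (hp : 1 ≤ p)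
    (φ : HypBoundary n → IsotropicSubspace p) (hφ : Measurable φ)
    (hchain : AlmostSurelyMapsChainsToChains φ)
    (htrans : ∀ᵐ xy ∂((boundaryMeasure n).prod (boundaryMeasure n)),
      (φ xy.1).Transverse (φ xy.2)) :
    ∃ E : Submodule ℂ EllTwo, HasSignature p E p (n * p) ∧
      ∀ᵐ x ∂(boundaryMeasure n), φ x ∈ boundaryAtInfinity (standardSubspace p E) := by
  have hne : (ae (boundaryMeasure n)).NeBot := ae_neBot.2 (boundaryMeasure_ne_zero hn)
  obtain ⟨W, hW, hWd, hWφ⟩ := exists_finrank_le_ae_le hn hφ hchain htrans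
  -- A transverse pair of images inside `W` provides the positive definite part of the signature.
  obtain ⟨x, hx, hxW⟩ := ((Measure.ae_ae_of_ae_prod htrans).and hWφ).exists
  obtain ⟨y, hy, hyW⟩ := (hx.and hWφ).exists
  obtain ⟨E, hE, hWE⟩ := exists_hasSignature W hWd hy hxW hyW
  refine ⟨E, hE, ?_⟩
  filter_upwards [hWφ] with z hz
  exact (mem_boundaryAtInfinity_standardSubspace hE _).2 (hz.trans hWE)
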